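/- **Conventions.** All posets are finite. An element $x$ of a lattice is reducible if $x=y\vee z$ or $x=y\wedge z$ for some $y,z$ both distinct from $x$. A block is a lattice whose least element $0$ and greatest element $1$ are both reducible. The nullity of a poset is the nullity $|E|-|V|+c$ of its cover graph ($c$ is the number of connected components). For a poset $P$, $\mathrm{Irr}(P)$ is the set of elements with at most one lower cover and at most one upper cover, $\mathrm{Red}(P)=P\setminus\mathrm{Irr}(P)$, and $\mathrm{Irr}^*(P)$ is the set of elements with exactly one lower cover and exactly one upper cover. An element $x\in\mathrm{Irr}(P)$ is retractible if either there are no $y,z\in\mathrm{Red}(P)$ with $y\prec x\prec z$, or there are such $y,z$ and there is no other directed path from $y$ to $z$ in $P$. A basic block associated to $P$ is obtained from $P$ by first removing successively retractible elements of $\mathrm{Irr}^*$ until there are none left, and then removing successively pendant vertices (vertices of degree one in the cover graph) until there are none left. The height of a poset is the number of coverings in a longest chain. Let $\mathscr{B}(j;5,3,5)$ be the class, up to isomorphism, of all blocks on $j$ elements that have exactly five reducible elements, these being pairwise comparable, that have nullity three, and whose associated basic block has height five. Let $P_n^k$ be the number of partitions of the integer $n$ into exactly $k$ positive parts. **Theorem.**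 For every integer $j\ge 9$, $$\begin{aligned} |\mathscr{B}(j;5,3,5)|={}&\sum_{p=6}^{j-3}2\binom{p-2}{4}P^2_{j-p-1} +\sum_{p=0}^{j-9}\ \sum_{q=0}^{j-p-9}\ \sum_{r=0}^{j-p-q-9}\ \sum_{s=1}^{j-p-q-r-8}\ \sum_{t=1}^{j-p-q-r-s-7}2P^2_{j-p-q-r-s-t-5}\\ &+\sum_{t=1}^{j-8}\ \sum_{k=1}^{j-t-7}\ \sum_{p=1}^{j-t-k-6}\ \sum_{l=2}^{j-t-k-p-4}6(l-1)P^2_{j-t-k-p-l-2}\\ &+\sum_{t=1}^{j-8}\ \sum_{h=2}^{j-t-6}\ \sum_{l=1}^{j-h-t-5}\ \sum_{p=1}^{j-h-t-l-4}2(h-1)P^2_{j-h-t-l-p-2}. \end{aligned}$$ -/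

import Mathlib

namespace LatticeCount

/-! ### Posets: nullity, doubly irreducible elements, basic retracts and basic blocks

All of this is applied to finite posets only. -/

section Poset

variable (P : Type*) [PartialOrder P]

/-- The nullity of a poset is the nullity (cyclomatic number `|E| - |V| + c`) of its cover graph. -/
noncomputable def nullity : ℤ :=
  ((SimpleGraph.hasse P).edgeSet.ncard : ℤ) - (Nat.card P : ℤ)
    + (Nat.card (SimpleGraph.hasse P).ConnectedComponent : ℤ)

variable {P}

/-- `x ∈ Irr(P)`: at most one lower cover and at most one upper cover. -/
def IsIrr (x : P) : Prop :=
  (∀ y y' : P, y ⋖ x → y' ⋖ x → y = y') ∧ (∀ z z' : P, x ⋖ z → x ⋖ z' → z = z')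

/-- `x ∈ Irr*(P)`: exactly one lower cover and exactly one upper cover. -/
def IsIrrStar (x : P) : Prop :=
  (∃! y : P, y ⋖ x) ∧ (∃! z : P, x ⋖ z)

/-- `x ∈ Irr(P)` is retractible if either there are no `y, z ∈ Red(P) = P \ Irr(P)` with
`y ⋖ x ⋖ z`, or there are such `y, z` and there is no other directed path (going up along
coverings) from `y` to `z`. In a finite poset with `y ⋖ x ⋖ z`, another directed path from `y` to
`z` exists exactly when some `w ≠ x` lies strictly between `y` and `z`. -/
def IsRetractible (x : P) : Prop :=
  IsIrr x ∧
    ((¬ ∃ y z : P, ¬ IsIrr y ∧ ¬ IsIrr z ∧ y ⋖ x ∧ x ⋖ z) ∨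
      (∃ y z : P, ¬ IsIrr y ∧ ¬ IsIrr z ∧ y ⋖ x ∧ x ⋖ z ∧
        ¬ ∃ w : P, w ≠ x ∧ y < w ∧ w < z))

/-- A pendant vertex of a poset: a vertex of degree one in the cover graph. -/
def IsPendant (x : P) : Prop :=
  ∃! y : P, (SimpleGraph.hasse P).Adj x y

/-- `T` is obtained from the subposet `S` of `P` by removing one element of `Irr*(S)` which is
retractible in `S`. -/
def RetractStep (S T : Set P) : Prop :=
  ∃ x : S, IsIrrStar x ∧ IsRetractible x ∧ T = S \ {(x : P)}

/-- `T` is obtained from the subposet `S` of `P` by removing one pendant vertex of `S`. -/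
def PendantStep (S T : Set P) : Prop :=
  ∃ x : S, IsPendant x ∧ T = S \ {(x : P)}

/-- The subposet `R` is a basic retract associated to `P`: it is obtained from `P` by successive
removal of retractible elements of `Irr*`, until there are none left. -/
def IsAssocBasicRetract (R : Set P) : Prop :=
  Relation.ReflTransGen RetractStep (Set.univ : Set P) R ∧
    ∀ x : R, IsIrrStar x → ¬ IsRetractible x

/-- The subposet `B` is a basic block associated to `P`: it is obtained from a basic retract
associated to `P` by successive removal of all the pendant vertices. -/
def IsAssocBasicBlock (B : Set P) : Prop :=
  ∃ R : Set P, IsAssocBasicRetract R ∧ Relation.ReflTransGen PendantStep R B ∧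
    ∀ x : B, ¬ IsPendant x

end Poset

/-! ### Lattices -/

section Lattice

variable {L : Type*} [Lattice L]

/-- `x` is reducible, i.e. join-reducible or meet-reducible. -/
def IsReducible (x : L) : Prop :=
  (∃ y z : L, y ≠ x ∧ z ≠ x ∧ y ⊔ z = x) ∨ (∃ y z : L, y ≠ x ∧ z ≠ x ∧ y ⊓ z = x)

variable (L)

/-- A block: a lattice with a least element `0` and a greatest element `1`, both reducible. -/
def IsBlock : Prop :=
  (∃ x : L, IsBot x ∧ IsReducible x) ∧ (∃ x : L, IsTop x ∧ IsReducible x)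

/-- `L` is a block with exactly `r` reducible elements, which are pairwise comparable, `L` has
nullity `k`, and the basic block associated to `L` has height `h` (the height of a finite poset is
the number of coverings in a longest chain). -/
def IsBlockOfType (r k h : ℕ) : Prop :=
  IsBlock L ∧
    IsChain (· ≤ ·) {x : L | IsReducible x} ∧
    {x : L | IsReducible x}.ncard = r ∧
    nullity L = k ∧
    ∃ B : Set L, IsAssocBasicBlock B ∧ Order.krullDim B = h

end Lattice

/-- Lattice structures on the `j`-element set `Fin j` that are blocks of type `(r, k, h)`. -/
def LabelledBlock (j r k h : ℕ) : Type :=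
  {L : Lattice (Fin j) // @IsBlockOfType (Fin j) L r k h}

/-- Two lattice structures on `Fin j` are equivalent if they are isomorphic. -/
def isoSetoid (j r k h : ℕ) : Setoid (LabelledBlock j r k h) where
  r L M := Nonempty (@OrderIso (Fin j) (Fin j) L.1.toLE M.1.toLE)
  iseqv :=
    { refl := fun L => ⟨@OrderIso.refl (Fin j) L.1.toLE⟩
      symm := fun {L M} ⟨e⟩ => ⟨@OrderIso.symm (Fin j) (Fin j) L.1.toLE M.1.toLE e⟩
      trans := fun {L M N} ⟨e⟩ ⟨f⟩ =>
        ⟨@OrderIso.trans (Fin j) (Fin j) (Fin j) L.1.toLE M.1.toLE N.1.toLE e f⟩ }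

/-- The class `𝓑(j; r, k, h)` of blocks of type `(r, k, h)` on `j` elements up to isomorphism. -/
def BlockClass (j r k h : ℕ) : Type :=
  Quotient (isoSetoid j r k h)

/-- `numPartitions k n` is `P_n^k`, the number of partitions of `n` into `k` positive parts. -/
noncomputable def numPartitions (k n : ℕ) : ℕ :=
  Nat.card {p : n.Partition // Multiset.card p.parts = k}

end LatticeCount

/-! Let r_0 < ... < r_4 be the reducible elements of such a block, r_0 the least and r_4 the
greatest element. Two incomparable elements have a reducible meet and a reducible join. This forces
the other elements into disjoint chains ("slots"), each hanging between two of the r_a, and the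
lattice is determined by the ends and lengths of its slots (`Spine.orderIso`). Conversely, slot data
define a lattice (`SlotData.Pt`).

A slot of n elements contributes n vertices and n + 1 edges to the cover graph, so the nullity is
the number of slots minus 4, and nullity three means seven slots. Each of the four gaps between
consecutive r_a contains a slot; three slots, the "ears", remain. Retraction shrinks a slot that is
alone in its gap to nothing and any other slot to one element, so the basic block has height 4 plus
the number of gaps with several slots. Height five thus means exactly one such gap
(`SlotData.Pt.isBlockOfType_iff`). An r_a is reducible exactly when two slots start there or two
slots end there, so the ears must touch all five r_a. Hence only one ear lies in a gap (if two lay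
in the same gap, the third would have to touch three elements), and a finite check leaves twelve
shapes (`exists_shape_of_areEars`).

In each shape the lengths are an unordered pair of positive integers in the doubled gap, two
positive integers for the other ears, and three nonnegative integers. An isomorphism fixes every r_a
and preserves the numbers of elements and of comparable pairs between r_a and r_b, which recovers
shape and lengths (`eq_of_shapeData_orderIso`). The count is therefore 12 N, where N, the number of
length vectors of sum j - 5, is a fivefold iterated sum of P^2 (`natCard_blockClass`). Each of the
four sums of the formula, stripped of its coefficient 2, 2, 6 or 2, is another way of writing N
(`sums_eq_iterSum`), and 2 + 2 + 6 + 2 = 12. -/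

namespace LatticeCount

/-! ### The lattice built from slot data -/

/-- Data for gluing chains onto a chain of `m + 1` elements: the chain (slot) `k` consists of
`n k` elements strictly between the elements number `s k` and number `t k` of the main chain.
Between consecutive elements of the main chain there is always a slot, and a slot may be empty only
if it is the only slot between two consecutive elements. -/
structure SlotData (m : ℕ) (K : Type) where
  s : K → Fin (m + 1)
  t : K → Fin (m + 1)
  n : K → ℕ
  lt : ∀ k, s k < t k
  gap : ∀ a : Fin m, ∃ k, s k = a.castSucc ∧ t k = a.succ
  simple_of_zero : ∀ k, n k = 0 →
    (t k : ℕ) = s k + 1 ∧ ∀ k', s k' = s k → t k' = t k → k' = k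

namespace SlotData

variable {m : ℕ} {K : Type}

/-- A slot is simple if it is the only slot between two consecutive elements. -/
def Simple (D : SlotData m K) (k : K) : Prop :=
  (D.t k : ℕ) = D.s k + 1 ∧ ∀ k', D.s k' = D.s k → D.t k' = D.t k → k' = k

/-- The elements of the poset described by slot data. -/
inductive Pt (D : SlotData m K) : Type
  | red (a : Fin (m + 1)) : Pt D
  | irr (k : K) (i : ℕ) (h : i < D.n k) : Pt D

namespace Pt

variable {D : SlotData m K}

/-- The largest element of the main chain below a given element. -/
def lo : Pt D → Fin (m + 1)
  | red a => a
  | irr k _ _ => D.s k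

/-- The least element of the main chain above a given element. -/
def hi : Pt D → Fin (m + 1)
  | red a => a
  | irr k _ _ => D.t k

/-- `x` precedes `y` in the same slot. -/
def SlotLE : Pt D → Pt D → Prop
  | irr k i _, irr k' i' _ => k = k' ∧ i ≤ i'
  | _, _ => False

instance : LE (Pt D) := ⟨fun x y => x.hi ≤ y.lo ∨ SlotLE x y⟩

@[simp] lemma lo_red (a : Fin (m + 1)) : (red a : Pt D).lo = a := rfl
@[simp] lemma hi_red (a : Fin (m + 1)) : (red a : Pt D).hi = a := rfl
@[simp] lemma lo_irr (k : K) (i : ℕ) (h : i < D.n k) : (irr k i h).lo = D.s k := rfl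
@[simp] lemma hi_irr (k : K) (i : ℕ) (h : i < D.n k) : (irr k i h).hi = D.t k := rfl

@[simp] lemma red_le_red {a b : Fin (m + 1)} : (red a : Pt D) ≤ red b ↔ a ≤ b :=
  or_iff_left id

@[simp] lemma red_le_irr {a : Fin (m + 1)} {k : K} {i : ℕ} {h : i < D.n k} :
    (red a : Pt D) ≤ irr k i h ↔ a ≤ D.s k :=
  or_iff_left id

@[simp] lemma irr_le_red {b : Fin (m + 1)} {k : K} {i : ℕ} {h : i < D.n k} :
    (irr k i h : Pt D) ≤ red b ↔ D.t k ≤ b :=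
  or_iff_left id

@[simp] lemma irr_le_irr {k k' : K} {i i' : ℕ} {h : i < D.n k} {h' : i' < D.n k'} :
    irr k i h ≤ irr k' i' h' ↔ D.t k ≤ D.s k' ∨ k = k' ∧ i ≤ i' :=
  Iff.rfl

instance : PartialOrder (Pt D) where
  le_refl x := by cases x <;> simp
  le_trans x y z hxy hyz := by
    rcases x with a | ⟨k, i, h⟩ <;> rcases y with b | ⟨k', i', h'⟩ <;>
      rcases z with c | ⟨k'', i'', h''⟩ <;> simp only [red_le_red, red_le_irr, irr_le_red,
        irr_le_irr] at * <;> grind [!. D.lt]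
  le_antisymm x y hxy hyx := by
    rcases x with a | ⟨k, i, h⟩ <;> rcases y with b | ⟨k', i', h'⟩ <;>
      simp only [red_le_red, red_le_irr, irr_le_red, irr_le_irr] at * <;> grind [!. D.lt]

@[simp] lemma red_lt_red {a b : Fin (m + 1)} : (red a : Pt D) < red b ↔ a < b := by
  simp only [lt_iff_le_not_ge, red_le_red]

@[simp] lemma red_lt_irr {a : Fin (m + 1)} {k : K} {i : ℕ} {h : i < D.n k} :
    (red a : Pt D) < irr k i h ↔ a ≤ D.s k := by
  have := D.lt k
  simp only [lt_iff_le_not_ge, red_le_irr, irr_le_red]; grind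

@[simp] lemma irr_lt_red {b : Fin (m + 1)} {k : K} {i : ℕ} {h : i < D.n k} :
    (irr k i h : Pt D) < red b ↔ D.t k ≤ b := by
  have := D.lt k
  simp only [lt_iff_le_not_ge, red_le_irr, irr_le_red]; grind

@[simp] lemma irr_lt_irr {k k' : K} {i i' : ℕ} {h : i < D.n k} {h' : i' < D.n k'} :
    irr k i h < irr k' i' h' ↔ D.t k ≤ D.s k' ∨ k = k' ∧ i < i' := by
  have := D.lt k
  have := D.lt k'
  simp only [lt_iff_le_not_ge, irr_le_irr]
  grind

lemma le_of_hi_le_lo {x y : Pt D} (h : x.hi ≤ y.lo) : x ≤ y := Or.inl h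

lemma le_red_iff {x : Pt D} {b : Fin (m + 1)} : x ≤ red b ↔ x.hi ≤ b := by
  cases x <;> simp

lemma red_le_iff {x : Pt D} {a : Fin (m + 1)} : red a ≤ x ↔ a ≤ x.lo := by
  cases x <;> simp

/-- A common upper bound inside the slot of x would have only elements comparable with x below it in
that slot, so two incomparable elements are bounded jointly only from the main chain onwards. This
makes the join of incomparable elements a point of the main chain. -/
lemma hi_max_le_of_incomparable {x y z : Pt D} (hxy : ¬ x ≤ y) (hyx : ¬ y ≤ x) (hx : x ≤ z)
    (hy : y ≤ z) : max x.hi y.hi ≤ z.lo := by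
  rcases x with a | ⟨k, i, h⟩ <;> rcases y with b | ⟨k', i', h'⟩ <;>
    rcases z with c | ⟨k'', i'', h''⟩ <;>
    simp only [red_le_red, red_le_irr, irr_le_red, irr_le_irr, lo_red, hi_red, lo_irr, hi_irr,
      max_le_iff] at * <;> grind

lemma hi_le_lo_min_of_incomparable {x y z : Pt D} (hxy : ¬ x ≤ y) (hyx : ¬ y ≤ x) (hx : z ≤ x)
    (hy : z ≤ y) : z.hi ≤ min x.lo y.lo := by
  rcases x with a | ⟨k, i, h⟩ <;> rcases y with b | ⟨k', i', h'⟩ <;>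
    rcases z with c | ⟨k'', i'', h''⟩ <;>
    simp only [red_le_red, red_le_irr, irr_le_red, irr_le_irr, lo_red, hi_red, lo_irr, hi_irr,
      le_min_iff] at * <;> grind

open Classical in
noncomputable instance : Lattice (Pt D) where
  sup x y := if x ≤ y then y else if y ≤ x then x else red (max x.hi y.hi)
  inf x y := if x ≤ y then x else if y ≤ x then y else red (min x.lo y.lo)
  le_sup_left x y := by
    split_ifs with h h'
    exacts [h, le_rfl, le_red_iff.2 (le_max_left _ _)]
  le_sup_right x y := by
    split_ifs with h h'
    exacts [le_rfl, h', le_red_iff.2 (le_max_right _ _)]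
  sup_le x y z hx hy := by
    split_ifs with h h'
    exacts [hy, hx, red_le_iff.2 (hi_max_le_of_incomparable h h' hx hy)]
  inf_le_left x y := by
    split_ifs with h h'
    exacts [le_rfl, h', red_le_iff.2 (min_le_left _ _)]
  inf_le_right x y := by
    split_ifs with h h'
    exacts [h, le_rfl, red_le_iff.2 (min_le_right _ _)]
  le_inf x y z hx hy := by
    split_ifs with h h'
    exacts [hx, hy, le_red_iff.2 (hi_le_lo_min_of_incomparable h h' hx hy)]

lemma sup_of_incomparable {x y : Pt D} (h : ¬ x ≤ y) (h' : ¬ y ≤ x) :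
    x ⊔ y = red (max x.hi y.hi) :=
  (if_neg h).trans (if_neg h')

lemma inf_of_incomparable {x y : Pt D} (h : ¬ x ≤ y) (h' : ¬ y ≤ x) :
    x ⊓ y = red (min x.lo y.lo) :=
  (if_neg h).trans (if_neg h')

/-- The elements are those of the main chain and those of the slots. -/
def equivSum (D : SlotData m K) : Pt D ≃ Fin (m + 1) ⊕ Σ k, Fin (D.n k) where
  toFun
    | red a => .inl a
    | irr k i h => .inr ⟨k, i, h⟩
  invFun
    | .inl a => red a
    | .inr ⟨k, i⟩ => irr k i i.2
  left_inv x := by cases x <;> rfl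
  right_inv x := by rcases x with a | ⟨k, i⟩ <;> rfl

instance [Finite K] : Finite (Pt D) := .of_equiv _ (equivSum D).symm

lemma natCard_eq [Fintype K] (D : SlotData m K) : Nat.card (Pt D) = m + 1 + ∑ k, D.n k := by
  rw [Nat.card_congr (equivSum D)]
  simp

lemma red_injective : Function.Injective (red : Fin (m + 1) → Pt D) :=
  fun _ _ h => red.inj h

/-! ### Coverings of the model -/

/-- The elements of the slot `k` in increasing order, numbered from `1` to `n k`, preceded and
followed by the elements of the main chain that bound the slot. -/
def walk (D : SlotData m K) (k : K) : ℕ → Pt D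
  | 0 => red (D.s k)
  | i + 1 => if h : i < D.n k then irr k i h else red (D.t k)

@[simp] lemma walk_zero (k : K) : walk D k 0 = red (D.s k) := rfl

lemma walk_succ_of_lt {k : K} {i : ℕ} (h : i < D.n k) : walk D k (i + 1) = irr k i h :=
  dif_pos h

@[simp] lemma walk_last (k : K) : walk D k (D.n k + 1) = red (D.t k) :=
  dif_neg (lt_irrefl _)

lemma walk_lt_walk_succ {k : K} {i : ℕ} (h : i ≤ D.n k) : walk D k i < walk D k (i + 1) := by
  have := D.lt k
  rcases i with _ | i
  · rcases Nat.eq_zero_or_pos (D.n k) with h0 | h0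
    · have := walk_last (D := D) k
      rw [h0] at this
      rw [this]
      simpa
    · simp [walk_succ_of_lt h0]
  · rw [walk_succ_of_lt h]
    rcases h.lt_or_eq with h' | h'
    · simp [walk_succ_of_lt h']
    · rw [h', walk_last]
      simp

/-- Element i of a slot sits at place i + 1 of the walk, so `walk D k i` is its predecessor;
everything strictly below the element passes through that predecessor. -/
lemma le_walk_of_lt_irr {z : Pt D} {k : K} {i : ℕ} {h : i < D.n k} (hz : z < irr k i h) :
    z ≤ walk D k i := by
  rcases i with _ | i
  · rcases z with a | ⟨k', i', h'⟩
    · simpa using hz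
    · simpa using hz
  · rw [walk_succ_of_lt (i.lt_succ_self.trans h)]
    rcases z with a | ⟨k', i', h'⟩
    · simpa using hz
    · simp only [irr_lt_irr, irr_le_irr] at *
      grind

lemma walk_le_of_irr_lt {z : Pt D} {k : K} {i : ℕ} {h : i < D.n k} (hz : irr k i h < z) :
    walk D k (i + 2) ≤ z := by
  by_cases h1 : i + 1 < D.n k
  on_goal 1 => rw [walk_succ_of_lt h1]
  on_goal 2 => rw [show i + 2 = D.n k + 1 by omega, walk_last]
  · rcases z with a | ⟨k', i', h'⟩
    · simpa using hz
    · simp only [irr_lt_irr, irr_le_irr] at *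
      grind
  · rcases z with a | ⟨k', i', h'⟩
    · simpa using hz
    · simp only [irr_lt_irr, red_le_irr] at *
      grind

lemma walk_covBy {k : K} {i : ℕ} (h : i ≤ D.n k) : walk D k i ⋖ walk D k (i + 1) := by
  refine ⟨walk_lt_walk_succ h, fun z hz hz' => ?_⟩
  rcases i with _ | i
  · rcases Nat.eq_zero_or_pos (D.n k) with h0 | h0
    -- Only an empty slot needs the axiom on empty slots: its ends are consecutive and no other slot
    -- joins them, so nothing lies in between.
    · obtain ⟨h1, h2⟩ := D.simple_of_zero k h0
      have h3 := walk_last (D := D) k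
      rw [h0] at h3
      rw [h3] at hz'
      rcases z with a | ⟨k', i', h'⟩
      · simp only [walk_zero, red_lt_red] at hz hz'
        grind
      · simp only [walk_zero, red_lt_irr, irr_lt_red] at hz hz'
        have := D.lt k'
        have := h2 k' (by grind) (by grind)
        grind
    · rw [walk_succ_of_lt h0] at hz'
      exact (le_walk_of_lt_irr hz').not_gt hz
  · rw [walk_succ_of_lt h] at hz
    exact (walk_le_of_irr_lt hz).not_gt hz'

/-- The coverings are exactly the steps of the walks. Together with `walk_pair_injective` this
parametrizes the edges of the cover graph. -/
lemma covBy_iff {x y : Pt D} : x ⋖ y ↔ ∃ k, ∃ i ≤ D.n k, x = walk D k i ∧ y = walk D k (i + 1) := by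
  refine ⟨fun h => ?_, ?_⟩
  · rcases y with b | ⟨k, i, hi⟩
    · rcases x with a | ⟨k, i, hi⟩
      · have hab : a < b := red_lt_red.1 h.lt
        obtain ⟨c, rfl⟩ := Fin.eq_castSucc_of_ne_last (x := a) (by grind)
        have hb : b = c.succ := by
          by_contra hne
          have : c.succ < b := lt_of_le_of_ne (Fin.castSucc_lt_iff_succ_le.1 hab) (Ne.symm hne)
          exact h.2 (red_lt_red.2 (Fin.castSucc_lt_succ (i := c))) (red_lt_red.2 this)
        subst hb
        obtain ⟨k, hs, ht⟩ := D.gap c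
        -- A nonempty slot in the gap would put its first element strictly between the two covering
        -- elements.
        have h0 : D.n k = 0 := by
          by_contra h0
          exact h.2 (c := irr k 0 (by omega)) (by simp [hs]) (by simp [ht])
        refine ⟨k, 0, by omega, by simp [hs], ?_⟩
        have := walk_last (D := D) k
        rw [h0] at this
        rw [this, ht]
      · refine ⟨k, i + 1, hi, (walk_succ_of_lt hi).symm, ?_⟩
        have h2 := walk_le_of_irr_lt h.lt
        refine (h2.eq_of_not_lt fun h3 => h.2 ?_ h3).symm
        rw [← walk_succ_of_lt hi]
        exact walk_lt_walk_succ hi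
    · refine ⟨k, i, hi.le, ?_, (walk_succ_of_lt hi).symm⟩
      have h2 := le_walk_of_lt_irr h.lt
      refine h2.eq_of_not_lt fun h3 => h.2 h3 ?_
      rw [← walk_succ_of_lt hi]
      exact walk_lt_walk_succ hi.le
  · rintro ⟨k, i, hi, rfl, rfl⟩
    exact walk_covBy hi

/-- A covering pair determines its slot and its place there. -/
lemma walk_pair_injective {k k' : K} {i i' : ℕ} (h : i ≤ D.n k) (h' : i' ≤ D.n k')
    (h1 : walk D k i = walk D k' i') (h2 : walk D k (i + 1) = walk D k' (i' + 1)) :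
    k = k' ∧ i = i' := by
  rcases i with _ | i
  · rcases i' with _ | i'
    · refine ⟨?_, rfl⟩
      simp only [walk_zero, red.injEq] at h1
      simp only [walk] at h2
      split_ifs at h2 with h3 h4 h4
      · exact (irr.inj h2).1
      · exact (D.simple_of_zero k' (by omega)).2 k h1 (red.inj h2)
    · rw [walk_succ_of_lt h'] at h1
      cases h1
  · rcases i' with _ | i'
    · rw [walk_succ_of_lt h] at h1
      cases h1
    · rw [walk_succ_of_lt h, walk_succ_of_lt h', irr.injEq] at h1
      exact ⟨h1.1, by rw [h1.2]⟩

/-! ### Reducible elements -/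

lemma isReducible_iff_red {x : Pt D} (hx : IsReducible x) : ∃ a, x = red a := by
  rcases hx with ⟨y, z, hy, hz, rfl⟩ | ⟨y, z, hy, hz, rfl⟩
  · refine ⟨_, sup_of_incomparable (fun h => hz ?_) (fun h => hy ?_)⟩
    exacts [(sup_eq_right.2 h).symm, (sup_eq_left.2 h).symm]
  · refine ⟨_, inf_of_incomparable (fun h => hy ?_) (fun h => hz ?_)⟩
    exacts [(inf_eq_left.2 h).symm, (inf_eq_right.2 h).symm]

/-- Two slots end at `a`, or two slots start at `a`. -/
def Branching (D : SlotData m K) (a : Fin (m + 1)) : Prop :=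
  (∃ k k', k ≠ k' ∧ D.t k = a ∧ D.t k' = a) ∨ (∃ k k', k ≠ k' ∧ D.s k = a ∧ D.s k' = a)

/-- Picks a slot through which x reaches a: the slot of x itself if that ends at a, otherwise a slot
in the gap just below a, which lies entirely above x. -/
lemma exists_slot_of_hi {x : Pt D} {a : Fin (m + 1)} (hx : x.hi ≤ a) (hxa : x ≠ red a) :
    ∃ k, D.t k = a ∧ ((∃ i h, x = irr k i h) ∨ x.hi ≤ D.s k) := by
  by_cases h : x.hi = a
  · rcases x with b | ⟨k, i, hi⟩
    · exact absurd (by rw [← h]; rfl) hxa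
    · exact ⟨k, h, .inl ⟨i, hi, rfl⟩⟩
  · obtain ⟨c, rfl⟩ := Fin.eq_succ_of_ne_zero (i := a) (by grind)
    obtain ⟨k, hs, ht⟩ := D.gap c
    exact ⟨k, ht, .inr (by grind)⟩

lemma exists_slot_of_lo {x : Pt D} {a : Fin (m + 1)} (hx : a ≤ x.lo) (hxa : x ≠ red a) :
    ∃ k, D.s k = a ∧ ((∃ i h, x = irr k i h) ∨ D.t k ≤ x.lo) := by
  by_cases h : x.lo = a
  · rcases x with b | ⟨k, i, hi⟩
    · exact absurd (by rw [← h]; rfl) hxa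
    · exact ⟨k, h, .inl ⟨i, hi, rfl⟩⟩
  · obtain ⟨c, rfl⟩ := Fin.eq_castSucc_of_ne_last (x := a) (by grind)
    obtain ⟨k, hs, ht⟩ := D.gap c
    exact ⟨k, hs, .inr (by grind)⟩

/-- If a is the join of incomparable y and z, the slots through which y and z reach a differ, since
sharing one would make y and z comparable or keep their join below a. Conversely, two slots ending
at a supply two lower covers with join a. Meets are dual. -/
lemma isReducible_red_iff {a : Fin (m + 1)} : IsReducible (red a : Pt D) ↔ Branching D a := by
  constructor
  · rintro (⟨y, z, hy, hz, hyz⟩ | ⟨y, z, hy, hz, hyz⟩)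
    · left
      have h1 : ¬ y ≤ z := fun h => hz (by rw [← hyz, sup_eq_right.2 h])
      have h2 : ¬ z ≤ y := fun h => hy (by rw [← hyz, sup_eq_left.2 h])
      rw [sup_of_incomparable h1 h2, red.injEq] at hyz
      obtain ⟨k, hk, hk'⟩ := exists_slot_of_hi ((le_max_left _ _).trans_eq hyz) hy
      obtain ⟨l, hl, hl'⟩ := exists_slot_of_hi ((le_max_right _ _).trans_eq hyz) hz
      refine ⟨k, l, ?_, hk, hl⟩
      rintro rfl
      have := D.lt k
      rcases hk' with ⟨i, hi, rfl⟩ | hk' <;> rcases hl' with ⟨i', hi', rfl⟩ | hl'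
      · simp only [irr_le_irr] at h1 h2
        grind
      · exact h2 (le_of_hi_le_lo hl')
      · exact h1 (le_of_hi_le_lo hk')
      · grind
    · right
      have h1 : ¬ y ≤ z := fun h => hy (by rw [← hyz, inf_eq_left.2 h])
      have h2 : ¬ z ≤ y := fun h => hz (by rw [← hyz, inf_eq_right.2 h])
      rw [inf_of_incomparable h1 h2, red.injEq] at hyz
      obtain ⟨k, hk, hk'⟩ := exists_slot_of_lo (hyz.symm.trans_le (min_le_left _ _)) hy
      obtain ⟨l, hl, hl'⟩ := exists_slot_of_lo (hyz.symm.trans_le (min_le_right _ _)) hz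
      refine ⟨k, l, ?_, hk, hl⟩
      rintro rfl
      have := D.lt k
      rcases hk' with ⟨i, hi, rfl⟩ | hk' <;> rcases hl' with ⟨i', hi', rfl⟩ | hl'
      · simp only [irr_le_irr] at h1 h2
        grind
      · exact h1 (le_of_hi_le_lo hl')
      · exact h2 (le_of_hi_le_lo hk')
      · grind
  · rintro (⟨k, l, hkl, rfl, hl⟩ | ⟨k, l, hkl, rfl, hl⟩)
    · have h1 := walk_covBy (D := D) (le_refl (D.n k))
      have h2 := walk_covBy (D := D) (le_refl (D.n l))
      rw [walk_last] at h1 h2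
      rw [hl] at h2
      refine .inl ⟨_, _, h1.lt.ne, h2.lt.ne, h1.wcovBy.sup_eq h2.wcovBy fun h => hkl ?_⟩
      exact (walk_pair_injective le_rfl le_rfl h (by simp [hl])).1
    · have h1 := walk_covBy (D := D) (Nat.zero_le (D.n k))
      have h2 := walk_covBy (D := D) (Nat.zero_le (D.n l))
      rw [walk_zero] at h1 h2
      rw [hl] at h2
      refine .inr ⟨_, _, h1.lt.ne', h2.lt.ne', h1.wcovBy.inf_eq h2.wcovBy fun h => hkl ?_⟩
      exact (walk_pair_injective (Nat.zero_le _) (Nat.zero_le _) (by simp [hl]) h).1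

lemma ncard_isReducible_eq_iff :
    {x : Pt D | IsReducible x}.ncard = m + 1 ↔ ∀ a, Branching D a := by
  have h : {x : Pt D | IsReducible x} ⊆ Set.range red := fun x hx => by
    obtain ⟨a, rfl⟩ := isReducible_iff_red hx
    exact ⟨a, rfl⟩
  have hc : (Set.range (red : _ → Pt D)).ncard = m + 1 := by
    rw [← Set.image_univ, Set.ncard_image_of_injective _ red_injective, Set.ncard_univ]
    simp
  constructor
  · intro h' a
    rw [← isReducible_red_iff]
    have := Set.eq_of_subset_of_ncard_le h (by rw [hc, h']) (Set.finite_range _)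
    have h2 : red a ∈ Set.range (red : _ → Pt D) := ⟨a, rfl⟩
    rwa [← this] at h2
  · intro h'
    rw [← hc]
    congr 1
    refine h.antisymm ?_
    rintro _ ⟨a, rfl⟩
    exact isReducible_red_iff.2 (h' a)

lemma isChain_isReducible : IsChain (· ≤ ·) {x : Pt D | IsReducible x} := by
  intro x hx y hy _
  obtain ⟨a, rfl⟩ := isReducible_iff_red hx
  obtain ⟨b, rfl⟩ := isReducible_iff_red hy
  simpa using le_total a b

lemma isBlock_of_branching (h : ∀ a, Branching D a) : IsBlock (Pt D) := by
  refine ⟨⟨red 0, fun x => red_le_iff.2 (Fin.zero_le _), isReducible_red_iff.2 (h _)⟩,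
    ⟨red (Fin.last m), fun x => le_red_iff.2 (Fin.le_last _), isReducible_red_iff.2 (h _)⟩⟩

/-! ### Nullity -/

lemma hasse_connected [Finite K] : (SimpleGraph.hasse (Pt D)).Connected := by
  have key : ∀ x : Pt D, (SimpleGraph.hasse (Pt D)).Reachable (red 0) x := by
    intro x
    refine wellFounded_lt.induction (C := fun x => (SimpleGraph.hasse (Pt D)).Reachable (red 0) x)
      x fun x ih => ?_
    by_cases hx : x = red 0
    · rw [hx]
    · have : red 0 < x := lt_of_le_of_ne (red_le_iff.2 (Fin.zero_le _)) (Ne.symm hx)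
      obtain ⟨y, -, hy⟩ := exists_le_covBy_of_lt this
      exact (ih y hy.lt).trans (SimpleGraph.Adj.reachable (.inl hy))
  exact { preconnected := fun x y => (key x).symm.trans (key y), nonempty := ⟨red 0⟩ }

/-- A slot with n elements is a path with n + 1 edges, and these paths partition the edges. -/
lemma ncard_edgeSet [Fintype K] :
    (SimpleGraph.hasse (Pt D)).edgeSet.ncard = ∑ k, D.n k + Fintype.card K := by
  let f : (Σ k, Fin (D.n k + 1)) → Sym2 (Pt D) := fun p => s(walk D p.1 p.2, walk D p.1 (p.2 + 1))
  have hf : Function.Injective f := by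
    rintro ⟨k, i⟩ ⟨k', i'⟩ h
    have hi := walk_lt_walk_succ (D := D) (Nat.le_of_lt_succ i.2)
    have hi' := walk_lt_walk_succ (D := D) (Nat.le_of_lt_succ i'.2)
    simp only [f, Sym2.eq_iff] at h
    rcases h with ⟨h1, h2⟩ | ⟨h1, h2⟩
    · obtain ⟨rfl, h⟩ :=
        walk_pair_injective (Nat.le_of_lt_succ i.2) (Nat.le_of_lt_succ i'.2) h1 h2
      obtain rfl := Fin.ext h
      rfl
    · rw [h1, h2] at hi
      exact absurd hi hi'.asymm
  have hr : (SimpleGraph.hasse (Pt D)).edgeSet = f '' Set.univ := by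
    ext e
    refine Sym2.ind (fun x y => ?_) e
    simp only [SimpleGraph.mem_edgeSet, SimpleGraph.hasse_adj, Set.image_univ, Set.mem_range, f]
    constructor
    · rintro (h | h)
      · obtain ⟨k, i, hi, rfl, rfl⟩ := covBy_iff.1 h
        exact ⟨⟨k, i, by omega⟩, rfl⟩
      · obtain ⟨k, i, hi, rfl, rfl⟩ := covBy_iff.1 h
        exact ⟨⟨k, i, by omega⟩, Sym2.eq_swap⟩
    · rintro ⟨⟨k, i⟩, h⟩
      have hi := walk_covBy (D := D) (Nat.le_of_lt_succ i.2)
      rcases Sym2.eq_iff.1 h with ⟨rfl, rfl⟩ | ⟨rfl, rfl⟩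
      exacts [.inl hi, .inr hi]
  rw [hr, Set.ncard_image_of_injective _ hf, Set.ncard_univ]
  simp [Finset.sum_add_distrib]

lemma nullity_eq [Fintype K] : nullity (Pt D) = (Fintype.card K : ℤ) - m := by
  have h1 : Nat.card (SimpleGraph.hasse (Pt D)).ConnectedComponent = 1 := by
    have := (hasse_connected (D := D)).preconnected.subsingleton_connectedComponent
    have : Nonempty (SimpleGraph.hasse (Pt D)).ConnectedComponent :=
      ⟨(SimpleGraph.hasse (Pt D)).connectedComponentMk (red 0)⟩
    exact Nat.card_eq_one_iff_unique.2 ⟨inferInstance, inferInstance⟩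
  rw [nullity, ncard_edgeSet, natCard_eq, h1]
  push_cast
  ring

/-! ### Basic retracts and basic blocks -/

/-- A subset that contains the main chain and meets all slots that are not simple. -/
structure IsFull (S : Set (Pt D)) : Prop where
  red_mem : ∀ a, red a ∈ S
  exists_mem : ∀ k, ¬ D.Simple k → ∃ i h, irr k i h ∈ S

namespace IsFull

variable {S : Set (Pt D)}

lemma univ : IsFull (Set.univ : Set (Pt D)) where
  red_mem _ := trivial
  exists_mem k hk := by
    have : 0 < D.n k := Nat.pos_of_ne_zero fun h => hk (D.simple_of_zero k h)
    exact ⟨0, this, trivial⟩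

/-- An element of the main chain, as an element of a full subset. -/
def red' (hS : IsFull S) (a : Fin (m + 1)) : S := ⟨red a, hS.red_mem a⟩

lemma lower_cover (hS : IsFull S) {k : K} {i : ℕ} {h : i < D.n k} {hx : irr k i h ∈ S} {y : S}
    (hy : y ⋖ ⟨irr k i h, hx⟩) : (y : Pt D) = red (D.s k) ∨ ∃ i' h', (y : Pt D) = irr k i' h' := by
  have h1 : (y : Pt D) < irr k i h := hy.lt
  have h2 : ¬ (y : Pt D) < red (D.s k) := fun h3 =>
    hy.2 (c := hS.red' (D.s k)) h3 (show red (D.s k) < irr k i h by simp)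
  obtain ⟨y, hyS⟩ := y
  rcases y with a | ⟨k', i', h'⟩
  · simp only [red_lt_irr, red_lt_red] at h1 h2
    exact .inl (by grind)
  · simp only [irr_lt_irr, irr_lt_red] at h1 h2
    obtain rfl : k' = k := by grind
    exact .inr ⟨_, _, rfl⟩

lemma upper_cover (hS : IsFull S) {k : K} {i : ℕ} {h : i < D.n k} {hx : irr k i h ∈ S} {y : S}
    (hy : ⟨irr k i h, hx⟩ ⋖ y) : (y : Pt D) = red (D.t k) ∨ ∃ i' h', (y : Pt D) = irr k i' h' := by
  have h1 : irr k i h < (y : Pt D) := hy.lt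
  have h2 : ¬ red (D.t k) < (y : Pt D) := fun h3 =>
    hy.2 (c := hS.red' (D.t k)) (show irr k i h < red (D.t k) by simp) h3
  obtain ⟨y, hyS⟩ := y
  rcases y with a | ⟨k', i', h'⟩
  · simp only [irr_lt_red, red_lt_red] at h1 h2
    exact .inl (by grind)
  · simp only [irr_lt_irr, red_lt_irr] at h1 h2
    obtain rfl : k = k' := by grind
    exact .inr ⟨_, _, rfl⟩

lemma le_total_of_slot {k : K} {x y : Pt D}
    (hx : x = red (D.s k) ∨ x = red (D.t k) ∨ ∃ i h, x = irr k i h)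
    (hy : y = red (D.s k) ∨ y = red (D.t k) ∨ ∃ i h, y = irr k i h) : x ≤ y ∨ y ≤ x := by
  have := D.lt k
  rcases hx with rfl | rfl | ⟨i, h, rfl⟩ <;> rcases hy with rfl | rfl | ⟨i', h', rfl⟩ <;>
    simp only [red_le_red, red_le_irr, irr_le_red, irr_le_irr] <;> grind

/-- All covers of a slot element inside S stay in its slot or are the slot's ends; these form a
chain, so the cover on each side is unique. -/
lemma isIrrStar [Finite K] (hS : IsFull S) {k : K} {i : ℕ} {h : i < D.n k} (hx : irr k i h ∈ S) :
    IsIrrStar (⟨irr k i h, hx⟩ : S) := by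
  constructor
  · obtain ⟨y, -, hy⟩ := exists_le_covBy_of_lt (a := hS.red' (D.s k)) (b := ⟨irr k i h, hx⟩)
      (show red (D.s k) < irr k i h by simp)
    refine ⟨y, hy, fun z hz => ?_⟩
    rcases le_total_of_slot (D := D) (k := k) (x := z) (y := y)
      ((hS.lower_cover hz).imp_right .inr) ((hS.lower_cover hy).imp_right .inr) with h1 | h1
    · exact (hz.eq_or_eq h1 hy.le).elim Eq.symm fun h => absurd h hy.lt.ne
    · exact (hy.eq_or_eq h1 hz.le).elim id fun h => absurd h hz.lt.ne
  · obtain ⟨y, hy, -⟩ := exists_covBy_le_of_lt (a := (⟨irr k i h, hx⟩ : S)) (b := hS.red' (D.t k))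
      (show irr k i h < red (D.t k) by simp)
    refine ⟨y, hy, fun z hz => ?_⟩
    rcases le_total_of_slot (D := D) (k := k) (x := z) (y := y)
      (.inr (hS.upper_cover hz)) (.inr (hS.upper_cover hy)) with h1 | h1
    · exact (hy.eq_or_eq hz.le h1).elim (fun h => absurd h hz.lt.ne') id
    · exact (hz.eq_or_eq hy.le h1).elim (fun h => absurd h hy.lt.ne') Eq.symm

lemma _root_.LatticeCount.IsIrrStar.isIrr {P : Type*} [PartialOrder P] {x : P} (h : IsIrrStar x) :
    IsIrr x :=
  ⟨fun _ _ h1 h2 => h.1.unique h1 h2, fun _ _ h1 h2 => h.2.unique h1 h2⟩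

/-- Even after retraction each slot still provides its own lower cover of its upper end: an element
of the slot, or the lower end when a simple slot has been emptied. Different slots provide different
covers, so branching survives in S. -/
lemma exists_lower_cover [Finite K] (hS : IsFull S) (k : K) : ∃ y : S, y ⋖ hS.red' (D.t k) ∧
    ((y : Pt D) = red (D.s k) ∧ D.Simple k ∨ ∃ i h, (y : Pt D) = irr k i h) := by
  by_cases hk : ∃ i h, irr k i h ∈ S
  · obtain ⟨i, h, hx⟩ := hk
    obtain ⟨⟨y, hyS⟩, hxy, hy⟩ := exists_le_covBy_of_lt (a := (⟨irr k i h, hx⟩ : S))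
      (b := hS.red' (D.t k)) (show irr k i h < red (D.t k) by simp)
    refine ⟨⟨y, hyS⟩, hy, .inr ?_⟩
    have h1 : y < red (D.t k) := hy.lt
    replace hxy : irr k i h ≤ y := hxy
    rcases y with a | ⟨k', i', h'⟩
    · simp only [irr_le_red, red_lt_red] at h1 hxy
      grind
    · simp only [irr_lt_red, irr_le_irr] at h1 hxy
      obtain rfl : k = k' := by have := D.lt k'; grind
      exact ⟨_, _, rfl⟩
  · have hs : D.Simple k := by
      by_contra hs
      exact hk (hS.exists_mem k hs)
    obtain ⟨⟨y, hyS⟩, hxy, hy⟩ := exists_le_covBy_of_lt (a := hS.red' (D.s k))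
      (b := hS.red' (D.t k)) (show red (D.s k) < red (D.t k) by simp [D.lt])
    refine ⟨⟨y, hyS⟩, hy, ?_⟩
    have h1 : y < red (D.t k) := hy.lt
    replace hxy : red (D.s k) ≤ y := hxy
    rcases y with a | ⟨k', i', h'⟩
    · simp only [red_le_red, red_lt_red] at h1 hxy
      have := hs.1
      exact .inl ⟨congrArg red (by grind), hs⟩
    · simp only [irr_lt_red, red_le_irr] at h1 hxy
      have := hs.1
      have := D.lt k'
      obtain rfl := hs.2 k' (by grind) (by grind)
      exact .inr ⟨_, _, rfl⟩

lemma exists_upper_cover [Finite K] (hS : IsFull S) (k : K) : ∃ y : S, hS.red' (D.s k) ⋖ y ∧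
    ((y : Pt D) = red (D.t k) ∧ D.Simple k ∨ ∃ i h, (y : Pt D) = irr k i h) := by
  by_cases hk : ∃ i h, irr k i h ∈ S
  · obtain ⟨i, h, hx⟩ := hk
    obtain ⟨⟨y, hyS⟩, hy, hxy⟩ := exists_covBy_le_of_lt (b := (⟨irr k i h, hx⟩ : S))
      (a := hS.red' (D.s k)) (show red (D.s k) < irr k i h by simp)
    refine ⟨⟨y, hyS⟩, hy, .inr ?_⟩
    have h1 : red (D.s k) < y := hy.lt
    replace hxy : y ≤ irr k i h := hxy
    rcases y with a | ⟨k', i', h'⟩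
    · simp only [red_le_irr, red_lt_red] at h1 hxy
      grind
    · simp only [red_lt_irr, irr_le_irr] at h1 hxy
      obtain rfl : k = k' := by have := D.lt k'; grind
      exact ⟨_, _, rfl⟩
  · have hs : D.Simple k := by
      by_contra hs
      exact hk (hS.exists_mem k hs)
    obtain ⟨⟨y, hyS⟩, hy, hxy⟩ := exists_covBy_le_of_lt (a := hS.red' (D.s k))
      (b := hS.red' (D.t k)) (show red (D.s k) < red (D.t k) by simp [D.lt])
    refine ⟨⟨y, hyS⟩, hy, ?_⟩
    have h1 : red (D.s k) < y := hy.lt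
    replace hxy : y ≤ red (D.t k) := hxy
    rcases y with a | ⟨k', i', h'⟩
    · simp only [red_le_red, red_lt_red] at h1 hxy
      have := hs.1
      exact .inl ⟨congrArg red (by grind), hs⟩
    · simp only [irr_le_red, red_lt_irr] at h1 hxy
      have := hs.1
      have := D.lt k'
      obtain rfl := hs.2 k' (by grind) (by grind)
      exact .inr ⟨_, _, rfl⟩

/-- An element of the main chain has two lower covers or two upper covers in a full subset. -/
lemma exists_two_covers [Finite K] (hS : IsFull S) {a : Fin (m + 1)} (ha : Branching D a) :
    (∃ y z, y ≠ z ∧ y ⋖ hS.red' a ∧ z ⋖ hS.red' a) ∨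
      (∃ y z, y ≠ z ∧ hS.red' a ⋖ y ∧ hS.red' a ⋖ z) := by
  rcases ha with ⟨k, l, hkl, rfl, hl⟩ | ⟨k, l, hkl, rfl, hl⟩
  · left
    obtain ⟨y, hy, hy'⟩ := hS.exists_lower_cover k
    obtain ⟨z, hz, hz'⟩ := hS.exists_lower_cover l
    rw [hl] at hz
    refine ⟨y, z, ?_, hy, hz⟩
    rintro rfl
    rcases hy' with ⟨h1, hs⟩ | ⟨i, h, h1⟩ <;> rcases hz' with ⟨h2, hs'⟩ | ⟨i', h', h2⟩
    all_goals have h3 := h1.symm.trans h2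
    exacts [hkl (hs'.2 k (red.inj h3) hl.symm), absurd h3 (by simp),
      absurd h3 (by simp), hkl (irr.inj h3).1]
  · right
    obtain ⟨y, hy, hy'⟩ := hS.exists_upper_cover k
    obtain ⟨z, hz, hz'⟩ := hS.exists_upper_cover l
    rw [hl] at hz
    refine ⟨y, z, ?_, hy, hz⟩
    rintro rfl
    rcases hy' with ⟨h1, hs⟩ | ⟨i, h, h1⟩ <;> rcases hz' with ⟨h2, hs'⟩ | ⟨i', h', h2⟩
    all_goals have h3 := h1.symm.trans h2
    exacts [hkl (hs'.2 k hl.symm (red.inj h3)), absurd h3 (by simp),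
      absurd h3 (by simp), hkl (irr.inj h3).1]

lemma not_isIrr_red [Finite K] (hD : ∀ a, Branching D a) (hS : IsFull S)
    (a : Fin (m + 1)) : ¬ IsIrr (hS.red' a) := by
  intro h
  rcases hS.exists_two_covers (hD a) with ⟨y, z, hyz, hy, hz⟩ | ⟨y, z, hyz, hy, hz⟩
  exacts [hyz (h.1 y z hy hz), hyz (h.2 y z hy hz)]

lemma eq_red_of_not_isIrr [Finite K] (hS : IsFull S) {x : S} (hx : ¬ IsIrr x) : ∃ a, x = hS.red' a := by
  obtain ⟨x, hxS⟩ := x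
  rcases x with a | ⟨k, i, h⟩
  · exact ⟨a, rfl⟩
  · exact absurd (hS.isIrrStar hxS).isIrr hx

end IsFull

end Pt

end SlotData

lemma exists_isAssocBasicRetract (P : Type*) [PartialOrder P] [Finite P] :
    ∃ R : Set P, IsAssocBasicRetract R := by
  have key : ∀ S : Set P, ∃ R, Relation.ReflTransGen RetractStep S R ∧
      ∀ x : R, IsIrrStar x → ¬ IsRetractible x := by
    intro S
    refine wellFounded_lt.induction (C := fun S : Set P => ∃ R,
      Relation.ReflTransGen RetractStep S R ∧ ∀ x : R, IsIrrStar x → ¬ IsRetractible x) S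
      fun S ih => ?_
    by_cases h : ∀ x : S, IsIrrStar x → ¬ IsRetractible x
    · exact ⟨S, .refl, h⟩
    · push Not at h
      obtain ⟨x, h1, h2⟩ := h
      obtain ⟨R, hR, hR'⟩ := ih (S \ {(x : P)}) (Set.sdiff_singleton_ssubset.2 x.2)
      exact ⟨R, hR.head ⟨x, h1, h2, rfl⟩, hR'⟩
  exact key _

namespace SlotData

variable {m : ℕ} {K : Type}

namespace Pt

variable {D : SlotData m K}

namespace IsFull

variable {S : Set (Pt D)}

/-- A slot that is not simple has an alternative route between its ends: through another slot of the
same gap, or through a main chain element skipped by it. -/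
lemma exists_between (hS : IsFull S) {k : K} (hk : ¬ D.Simple k) :
    ∃ w : S, hS.red' (D.s k) < w ∧ w < hS.red' (D.t k) ∧ ∀ i h, (w : Pt D) ≠ irr k i h := by
  have := D.lt k
  by_cases h : (D.t k : ℕ) = D.s k + 1
  · have h2 : ∃ k', D.s k' = D.s k ∧ D.t k' = D.t k ∧ k' ≠ k := by
      by_contra h3
      push Not at h3
      exact hk ⟨h, h3⟩
    obtain ⟨k', hs, ht, hne⟩ := h2
    obtain ⟨i, hi, hmem⟩ := hS.exists_mem k' fun h3 => hne (h3.2 k hs.symm ht.symm).symm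
    refine ⟨⟨_, hmem⟩, ?_, ?_, fun j hj h3 => hne (irr.inj h3).1⟩
    · exact red_lt_irr.2 hs.ge
    · exact irr_lt_red.2 ht.le
  · refine ⟨hS.red' ⟨D.s k + 1, by omega⟩, ?_, ?_, fun j hj h3 => ?_⟩
    · exact red_lt_red.2 (Fin.lt_def.2 (Nat.lt_succ_self _))
    · refine red_lt_red.2 (Fin.lt_def.2 ?_)
      change (D.s k : ℕ) + 1 < D.t k
      omega
    · cases h3

/-- The last remaining element of a slot that is not simple is covered by and covers reducible
elements, and `exists_between` gives another path between these; so it is not retractible. Elements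
of the main chain are never in Irr. -/
lemma of_retractStep [Finite K] (hD : ∀ a, Branching D a) (hS : IsFull S) {T : Set (Pt D)}
    (h : RetractStep S T) : IsFull T := by
  obtain ⟨⟨x, hx⟩, hstar, hret, rfl⟩ := h
  rcases x with a | ⟨k, i, hi⟩
  · exact absurd hret.1 (hS.not_isIrr_red hD a)
  refine ⟨fun a => ⟨hS.red_mem a, by simp⟩, fun l hl => ?_⟩
  by_cases hne : ∃ i' h', irr l i' h' ∈ S ∧ irr l i' h' ≠ irr k i hi
  · obtain ⟨i', h', h1, h2⟩ := hne
    exact ⟨i', h', h1, h2⟩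
  · exfalso
    push Not at hne
    obtain ⟨i', h', h1⟩ := hS.exists_mem l hl
    obtain rfl : l = k := (irr.inj (hne i' h' h1)).1
    obtain ⟨y, hy, hyu⟩ := hstar.1
    obtain ⟨z, hz, hzu⟩ := hstar.2
    have hy' : y = hS.red' (D.s l) := by
      rcases hS.lower_cover hy with h | ⟨i', h', h⟩
      · exact Subtype.ext h
      · have := hne i' h' (h ▸ y.2)
        rw [← h] at this
        exact absurd (Subtype.ext this) hy.lt.ne
    have hz' : z = hS.red' (D.t l) := by
      rcases hS.upper_cover hz with h | ⟨i', h', h⟩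
      · exact Subtype.ext h
      · have := hne i' h' (h ▸ z.2)
        rw [← h] at this
        exact absurd (Subtype.ext this) hz.lt.ne'
    subst hy' hz'
    rcases hret.2 with h | ⟨y, z, -, -, h3, h4, h⟩
    · exact h ⟨_, _, hS.not_isIrr_red hD _, hS.not_isIrr_red hD _, hy, hz⟩
    · obtain rfl := hyu y h3
      obtain rfl := hzu z h4
      obtain ⟨w, hw1, hw2, hw⟩ := hS.exists_between hl
      exact h ⟨w, fun h5 => hw _ _ (congrArg Subtype.val h5), hw1, hw2⟩

lemma of_reflTransGen [Finite K] (hD : ∀ a, Branching D a) (hS : IsFull S) {T : Set (Pt D)}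
    (h : Relation.ReflTransGen RetractStep S T) : IsFull T := by
  induction h with
  | refl => exact hS
  | tail _ h ih => exact ih.of_retractStep hD h

/-- Of two elements left in one slot, the lower one has no reducible upper cover, so it is
retractible by the first clause of the definition. -/
lemma eq_of_terminal [Finite K] (hS : IsFull S)
    (hterm : ∀ x : S, IsIrrStar x → ¬ IsRetractible x) {k : K} {i i' : ℕ} {h : i < D.n k}
    {h' : i' < D.n k} (hx : irr k i h ∈ S) (hx' : irr k i' h' ∈ S) : i = i' := by
  wlog hlt : i < i' generalizing i i' with H
  · rcases lt_trichotomy i i' with h1 | h1 | h1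
    exacts [absurd h1 hlt, h1, (H hx' hx h1).symm]
  · exfalso
    refine hterm ⟨_, hx⟩ (hS.isIrrStar hx) ⟨(hS.isIrrStar hx).isIrr, .inl ?_⟩
    rintro ⟨y, z, -, hz, -, hxz⟩
    obtain ⟨a, rfl⟩ := hS.eq_red_of_not_isIrr hz
    refine hxz.2 (c := ⟨_, hx'⟩) (irr_lt_irr.2 (.inr ⟨rfl, hlt⟩)) ?_
    exact irr_lt_red.2 (irr_lt_red.1 hxz.lt)

/-- The only element left in a simple slot is the only element between its two reducible covers, so
it is retractible by the second clause of the definition. -/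
lemma notMem_of_terminal [Finite K] (hD : ∀ a, Branching D a) (hS : IsFull S)
    (hterm : ∀ x : S, IsIrrStar x → ¬ IsRetractible x) {k : K} (hk : D.Simple k) {i : ℕ}
    {h : i < D.n k} : irr k i h ∉ S := by
  intro hx
  have key : ∀ w : S, hS.red' (D.s k) < w → w < hS.red' (D.t k) → w = ⟨irr k i h, hx⟩ := by
    rintro ⟨w, hw⟩ h1 h2
    replace h1 : red (D.s k) < w := h1
    replace h2 : w < red (D.t k) := h2
    have := hk.1
    rcases w with a | ⟨l, i', h'⟩
    · simp only [red_lt_red] at h1 h2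
      grind
    · simp only [red_lt_irr, irr_lt_red] at h1 h2
      have := D.lt l
      obtain rfl := hk.2 l (by grind) (by grind)
      obtain rfl := hS.eq_of_terminal hterm hx hw
      rfl
  have h1 : hS.red' (D.s k) < ⟨irr k i h, hx⟩ := red_lt_irr.2 le_rfl
  have h2 : ⟨irr k i h, hx⟩ < hS.red' (D.t k) := irr_lt_red.2 le_rfl
  refine hterm ⟨_, hx⟩ (hS.isIrrStar hx) ⟨(hS.isIrrStar hx).isIrr, .inr
    ⟨hS.red' (D.s k), hS.red' (D.t k), hS.not_isIrr_red hD _, hS.not_isIrr_red hD _,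
      ⟨h1, fun w hw hw' => ?_⟩, ⟨h2, fun w hw hw' => ?_⟩, ?_⟩⟩
  · exact hw'.ne (key w hw (hw'.trans h2))
  · exact hw.ne' (key w (h1.trans hw) hw')
  · rintro ⟨w, hw, hw1, hw2⟩
    exact hw (key w hw1 hw2)

lemma not_isPendant [Finite K] (hD : ∀ a, Branching D a) (hS : IsFull S) (x : S) :
    ¬ IsPendant x := by
  intro h
  obtain ⟨x, hx⟩ := x
  rcases x with a | ⟨k, i, hi⟩
  · rcases hS.exists_two_covers (hD a) with ⟨y, z, hyz, hy, hz⟩ | ⟨y, z, hyz, hy, hz⟩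
    exacts [hyz (h.unique (.inr hy) (.inr hz)), hyz (h.unique (.inl hy) (.inl hz))]
  · obtain ⟨⟨y, hy, -⟩, ⟨z, hz, -⟩⟩ := hS.isIrrStar hx
    exact (hy.lt.trans hz.lt).ne (h.unique (.inr hy) (.inl hz))

end IsFull

/-- A full subset has no pendant vertices, so the second stage of the construction removes nothing.
-/
lemma isAssocBasicBlock_iff [Finite K] (hD : ∀ a, Branching D a) {B : Set (Pt D)} :
    IsAssocBasicBlock B ↔ IsAssocBasicRetract B := by
  constructor
  · rintro ⟨R, hR, hRB, -⟩
    have hfull := IsFull.univ.of_reflTransGen hD hR.1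
    rcases hRB.cases_head with rfl | ⟨T, ⟨x, hx, -⟩, -⟩
    · exact hR
    · exact absurd hx (hfull.not_isPendant hD x)
  · intro hB
    exact ⟨B, hB, .refl, (IsFull.univ.of_reflTransGen hD hB.1).not_isPendant hD⟩

/-! ### Height of a basic block -/

open Classical in
/-- The length of a longest chain of a basic block between the elements number `c` and `c + 1` of
the main chain. -/
noncomputable def gapLength (D : SlotData m K) (c : Fin m) : ℕ :=
  if ∃ k, D.s k = c.castSucc ∧ D.t k = c.succ ∧ D.Simple k then 1 else 2

lemma one_le_gapLength (c : Fin m) : 1 ≤ gapLength D c := by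
  unfold gapLength
  split_ifs <;> omega

/-- The height in a basic block of the element number `a` of the main chain. -/
noncomputable def blockHeight (D : SlotData m K) (a : Fin (m + 1)) : ℕ :=
  ∑ c : Fin m with c.castSucc < a, gapLength D c

lemma blockHeight_succ (c : Fin m) :
    blockHeight D c.succ = blockHeight D c.castSucc + gapLength D c := by
  have : (Finset.univ.filter fun d : Fin m => d.castSucc < c.succ)
      = insert c (Finset.univ.filter fun d : Fin m => d.castSucc < c.castSucc) := by
    ext d
    simp only [Finset.mem_filter, Finset.mem_insert, Finset.mem_univ, true_and]
    grind
  rw [blockHeight, this, Finset.sum_insert (by simp), blockHeight, add_comm]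

lemma blockHeight_lt {a b : Fin (m + 1)} (h : a < b) : blockHeight D a < blockHeight D b := by
  obtain ⟨c, rfl⟩ := Fin.eq_castSucc_of_ne_last (x := a) (by grind)
  have h1 : blockHeight D c.castSucc < blockHeight D c.succ := by
    rw [blockHeight_succ]
    have := one_le_gapLength (D := D) c
    omega
  refine h1.trans_le (Finset.sum_le_sum_of_subset fun d => ?_)
  simp only [Finset.mem_filter, Finset.mem_univ, true_and]
  grind

lemma blockHeight_le {a b : Fin (m + 1)} (h : a ≤ b) : blockHeight D a ≤ blockHeight D b :=
  h.eq_or_lt.elim (fun h => h ▸ le_rfl) fun h => (blockHeight_lt h).le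

lemma blockHeight_add_two_le {k : K} (hk : ¬ D.Simple k) :
    blockHeight D (D.s k) + 2 ≤ blockHeight D (D.t k) := by
  have h := D.lt k
  obtain ⟨c, hc⟩ := Fin.eq_castSucc_of_ne_last (x := D.s k) (by grind)
  have h1 := blockHeight_succ (D := D) c
  rw [hc] at h1
  rcases (show c.succ ≤ D.t k by grind).eq_or_lt with h2 | h2
  · rw [← h2]
    have : gapLength D c = 2 := by
      refine if_neg ?_
      rintro ⟨k', h3, h4, h5⟩
      exact hk (h5.2 k (hc.symm.trans h3.symm) (h2.symm.trans h4.symm) ▸ h5)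
    omega
  · have := blockHeight_lt (D := D) h2
    have := one_le_gapLength (D := D) c
    omega

lemma blockHeight_last : blockHeight D (Fin.last m) = ∑ c, gapLength D c := by
  rw [blockHeight, Finset.filter_true_of_mem]
  intro c _
  exact Fin.castSucc_lt_last c

lemma krullDim_le [Finite K] (hD : ∀ a, Branching D a) {S : Set (Pt D)} (hS : IsFull S)
    (hterm : ∀ x : S, IsIrrStar x → ¬ IsRetractible x) :
    Order.krullDim S ≤ (∑ c, gapLength D c : ℕ) := by
  -- A rank function, strictly increasing on S because a surviving slot element lies in a slot that
  -- is not simple, whose ends differ in height by at least two.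
  let f : Pt D → ℕ := fun x => match x with
    | red a => blockHeight D a
    | irr k _ _ => blockHeight D (D.s k) + 1
  have hf : ∀ x : S, f x ≤ ∑ c, gapLength D c := by
    rintro ⟨x, hx⟩
    rw [← blockHeight_last]
    rcases x with a | ⟨k, i, h⟩
    · exact blockHeight_le (Fin.le_last _)
    · exact (blockHeight_lt (D.lt k)).trans_le (blockHeight_le (Fin.le_last _))
  have hmono : ∀ x y : S, x < y → f x < f y := by
    rintro ⟨x, hx⟩ ⟨y, hy⟩ h
    replace h : x < y := h
    rcases x with a | ⟨k, i, hi⟩ <;> rcases y with b | ⟨l, j, hj⟩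
    · exact blockHeight_lt (red_lt_red.1 h)
    · exact Nat.lt_succ_of_le (blockHeight_le (red_lt_irr.1 h))
    · have h1 : ¬ D.Simple k := fun h1 => hS.notMem_of_terminal hD hterm h1 hx
      have := blockHeight_add_two_le h1
      have := blockHeight_le (D := D) (irr_lt_red.1 h)
      simp only [f]
      omega
    · have h1 : ¬ D.Simple k := fun h1 => hS.notMem_of_terminal hD hterm h1 hx
      have := blockHeight_add_two_le h1
      rcases irr_lt_irr.1 h with h2 | ⟨rfl, h2⟩
      · have := blockHeight_le (D := D) h2
        simp only [f]
        omega
      · exact absurd (hS.eq_of_terminal hterm hx hy) h2.ne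
  refine iSup_le fun p => ?_
  have h1 : ∀ i : Fin (p.length + 1), (i : ℕ) ≤ f (p i) := by
    intro i
    induction i using Fin.induction with
    | zero => simp
    | succ i ih =>
      have := hmono _ _ (p.step i)
      simp only [Fin.val_castSucc, Fin.val_succ] at *
      omega
  have h2 := (h1 (Fin.last _)).trans (hf _)
  rw [Fin.val_last] at h2
  exact_mod_cast h2

/-- A long chain is built along the main chain, with a detour through one more element in every gap
that has no simple slot. -/
lemma le_krullDim {S : Set (Pt D)} (hS : IsFull S) :
    ((∑ c, gapLength D c : ℕ) : WithBot ℕ∞) ≤ Order.krullDim S := by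
  have key : ∀ a, (blockHeight D a : ℕ∞) ≤ Order.height (hS.red' a) := by
    intro a
    induction a using Fin.induction with
    | zero => simp [blockHeight]
    | succ c ih =>
      rw [blockHeight_succ]
      have h1 : hS.red' c.castSucc < hS.red' c.succ := red_lt_red.2 Fin.castSucc_lt_succ
      by_cases hc : ∃ k, D.s k = c.castSucc ∧ D.t k = c.succ ∧ D.Simple k
      · rw [gapLength, if_pos hc]
        push_cast
        exact (add_le_add_left ih 1).trans (Order.height_add_one_le h1)
      · rw [gapLength, if_neg hc]
        obtain ⟨k, hs, ht⟩ := D.gap c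
        obtain ⟨w, hw1, hw2, -⟩ := hS.exists_between fun h => hc ⟨k, hs, ht, h⟩
        rw [hs] at hw1
        rw [ht] at hw2
        have h2 := (add_le_add_left ih 1).trans (Order.height_add_one_le hw1)
        have h3 := (add_le_add_left h2 1).trans (Order.height_add_one_le hw2)
        rw [add_assoc] at h3
        push_cast
        exact h3
  rw [← blockHeight_last]
  refine le_trans ?_ (Order.height_le_krullDim (hS.red' (Fin.last m)))
  exact_mod_cast key _

lemma exists_isAssocBasicBlock_iff [Finite K] (hD : ∀ a, Branching D a) (h : ℕ) :
    (∃ B : Set (Pt D), IsAssocBasicBlock B ∧ Order.krullDim B = h) ↔ ∑ c, gapLength D c = h := by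
  have key : ∀ B : Set (Pt D), IsAssocBasicBlock B →
      Order.krullDim B = (∑ c, gapLength D c : ℕ) := by
    intro B hB
    rw [isAssocBasicBlock_iff hD] at hB
    have hfull := IsFull.univ.of_reflTransGen hD hB.1
    exact (krullDim_le hD hfull hB.2).antisymm (le_krullDim hfull)
  constructor
  · rintro ⟨B, hB, hB'⟩
    rw [key B hB] at hB'
    exact_mod_cast hB'
  · rintro rfl
    obtain ⟨B, hB⟩ := exists_isAssocBasicRetract (Pt D)
    rw [← isAssocBasicBlock_iff hD] at hB
    exact ⟨B, hB, key B hB⟩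

/-- Which slot data describe blocks of a given type. -/
theorem isBlockOfType_iff [Fintype K] (k h : ℕ) : IsBlockOfType (Pt D) (m + 1) k h ↔
    (∀ a, Branching D a) ∧ Fintype.card K = m + k ∧ ∑ c, gapLength D c = h := by
  rw [IsBlockOfType, ncard_isReducible_eq_iff, nullity_eq]
  constructor
  · rintro ⟨-, -, h1, h2, h3⟩
    exact ⟨h1, by omega, (exists_isAssocBasicBlock_iff h1 h).1 h3⟩
  · rintro ⟨h1, h2, h3⟩
    exact ⟨isBlock_of_branching h1, isChain_isReducible, h1, by omega,
      (exists_isAssocBasicBlock_iff h1 h).2 h3⟩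

end Pt

end SlotData

/-! ### Invariance under isomorphisms -/

section Transport

variable {P Q : Type*} [PartialOrder P] [PartialOrder Q]

lemma isIrr_apply_iff (e : P ≃o Q) {x : P} : IsIrr (e x) ↔ IsIrr x := by
  simp only [IsIrr, e.surjective.forall, apply_covBy_apply_iff, e.injective.eq_iff]

lemma isIrrStar_apply_iff (e : P ≃o Q) {x : P} : IsIrrStar (e x) ↔ IsIrrStar x := by
  simp only [IsIrrStar, ExistsUnique, e.surjective.exists, e.surjective.forall,
    apply_covBy_apply_iff, e.injective.eq_iff]

lemma isRetractible_apply_iff (e : P ≃o Q) {x : P} : IsRetractible (e x) ↔ IsRetractible x := by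
  simp only [IsRetractible, e.surjective.exists, apply_covBy_apply_iff, isIrr_apply_iff,
    e.injective.ne_iff, e.lt_iff_lt]

lemma isPendant_apply_iff (e : P ≃o Q) {x : P} : IsPendant (e x) ↔ IsPendant x := by
  simp only [IsPendant, ExistsUnique, e.surjective.exists, e.surjective.forall,
    SimpleGraph.hasse_adj, apply_covBy_apply_iff, e.injective.eq_iff]

/-- An order isomorphism maps a subset isomorphically onto its image. -/
def imageOrderIso (e : P ≃o Q) (S : Set P) : S ≃o (e '' S) where
  toEquiv := e.toEquiv.image S
  map_rel_iff' := e.le_iff_le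

lemma retractStep_image (e : P ≃o Q) {S T : Set P} (h : RetractStep S T) :
    RetractStep (e '' S) (e '' T) := by
  obtain ⟨x, h1, h2, rfl⟩ := h
  refine ⟨imageOrderIso e S x, (isIrrStar_apply_iff _).2 h1, (isRetractible_apply_iff _).2 h2, ?_⟩
  rw [Set.image_sdiff e.injective, Set.image_singleton]
  rfl

lemma pendantStep_image (e : P ≃o Q) {S T : Set P} (h : PendantStep S T) :
    PendantStep (e '' S) (e '' T) := by
  obtain ⟨x, h1, rfl⟩ := h
  refine ⟨imageOrderIso e S x, (isPendant_apply_iff _).2 h1, ?_⟩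
  rw [Set.image_sdiff e.injective, Set.image_singleton]
  rfl

lemma isAssocBasicRetract_image (e : P ≃o Q) {R : Set P} (h : IsAssocBasicRetract R) :
    IsAssocBasicRetract (e '' R) := by
  refine ⟨?_, ?_⟩
  · have := h.1.lift (e '' ·) fun _ _ => retractStep_image e
    change Relation.ReflTransGen _ (e '' Set.univ) _ at this
    rwa [Set.image_univ, e.surjective.range_eq] at this
  · rw [(imageOrderIso e R).surjective.forall]
    intro x
    rw [isIrrStar_apply_iff, isRetractible_apply_iff]
    exact h.2 x

lemma isAssocBasicBlock_image (e : P ≃o Q) {B : Set P} (h : IsAssocBasicBlock B) :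
    IsAssocBasicBlock (e '' B) := by
  obtain ⟨R, hR, hRB, hB⟩ := h
  refine ⟨e '' R, isAssocBasicRetract_image e hR,
    hRB.lift (e '' ·) fun _ _ => pendantStep_image e, ?_⟩
  rw [(imageOrderIso e B).surjective.forall]
  intro x
  rw [isPendant_apply_iff]
  exact hB x

lemma nullity_congr (e : P ≃o Q) : nullity P = nullity Q := by
  let φ : SimpleGraph.hasse P ≃g SimpleGraph.hasse Q :=
    { toEquiv := e.toEquiv
      map_rel_iff' := by simp }
  have h1 : (SimpleGraph.hasse P).edgeSet.ncard = (SimpleGraph.hasse Q).edgeSet.ncard :=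
    Nat.card_congr φ.mapEdgeSet
  rw [nullity, nullity, h1, Nat.card_congr e.toEquiv, Nat.card_congr φ.connectedComponentEquiv]

end Transport

section TransportLattice

variable {L M : Type*} [Lattice L] [Lattice M]

lemma isReducible_apply_iff (e : L ≃o M) {x : L} : IsReducible (e x) ↔ IsReducible x := by
  simp only [IsReducible, e.surjective.exists, ← map_sup, ← map_inf, e.injective.ne_iff,
    e.injective.eq_iff]

lemma IsBlockOfType.of_orderIso (e : L ≃o M) {r k h : ℕ} (hL : IsBlockOfType L r k h) :
    IsBlockOfType M r k h := by
  obtain ⟨⟨⟨x, hx, hx'⟩, ⟨y, hy, hy'⟩⟩, h2, h3, h4, B, hB, hB'⟩ := hL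
  have hs : {x : M | IsReducible x} = e '' {x : L | IsReducible x} := by
    ext z
    obtain ⟨z, rfl⟩ := e.surjective z
    simp [isReducible_apply_iff, e.injective.eq_iff]
  refine ⟨⟨⟨e x, e.surjective.forall.2 fun z => e.le_iff_le.2 (hx z),
    (isReducible_apply_iff e).2 hx'⟩, ⟨e y, e.surjective.forall.2 fun z => e.le_iff_le.2 (hy z),
    (isReducible_apply_iff e).2 hy'⟩⟩,
    ?_, ?_, ?_, e '' B, isAssocBasicBlock_image e hB, ?_⟩
  · rw [hs]
    rintro _ ⟨a, ha, rfl⟩ _ ⟨b, hb, rfl⟩ hne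
    have := h2 ha hb (fun h => hne (congrArg e h))
    simpa using this
  · rw [hs, Set.ncard_image_of_injective _ e.injective, h3]
  · rw [← nullity_congr e, h4]
  · rw [← hB', Order.krullDim_eq_of_orderIso (imageOrderIso e B)]

end TransportLattice

/-! ### Decomposition of a lattice whose reducible elements form a chain -/

lemma exists_orderIso_fin_of_isChain {P : Type*} [PartialOrder P] [Finite P] {S : Set P}
    (hS : IsChain (· ≤ ·) S) : Nonempty (Fin S.ncard ≃o S) := by
  classical
  let _ : LinearOrder S :=
    { (inferInstance : PartialOrder S) with
      le_total := fun x y => by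
        by_cases h : (x : P) = y
        · exact .inl h.le
        · exact hS x.2 y.2 h
      toDecidableLE := Classical.decRel _ }
  have := Fintype.ofFinite S
  exact ⟨Fintype.orderIsoFinOfCardEq S (by rw [← Nat.card_eq_fintype_card]; rfl)⟩

section Decomposition

/-- An increasing enumeration of the reducible elements of a lattice, from least to greatest. -/
structure Spine (L : Type) [Lattice L] (m : ℕ) where
  r : Fin (m + 1) → L
  strictMono : StrictMono r
  isReducible_iff : ∀ x, IsReducible x ↔ ∃ a, r a = x
  r_zero_le : ∀ x, r 0 ≤ x
  le_r_last : ∀ x, x ≤ r (Fin.last m)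

variable {L : Type} [Lattice L] {m : ℕ}

lemma exists_spine [Finite L] (hb : IsBlock L) (hc : IsChain (· ≤ ·) {x : L | IsReducible x})
    (hn : {x : L | IsReducible x}.ncard = m + 1) : Nonempty (Spine L m) := by
  obtain ⟨e⟩ := exists_orderIso_fin_of_isChain hc
  rw [hn] at e
  obtain ⟨⟨x, hx, hx'⟩, ⟨y, hy, hy'⟩⟩ := hb
  refine ⟨⟨fun a => e a, fun a b h => e.lt_iff_lt.2 h, fun x => ⟨fun h => ?_, ?_⟩, fun z => ?_,
    fun z => ?_⟩⟩
  · exact ⟨e.symm ⟨x, h⟩, by simp⟩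
  · rintro ⟨a, rfl⟩
    exact (e a).2
  · have : e 0 ≤ ⟨x, hx'⟩ := by
      rw [← e.symm_apply_apply 0, ← e.le_symm_apply]
      simp
    exact le_trans this (hx z)
  · have : ⟨y, hy'⟩ ≤ e (Fin.last m) := by
      rw [← e.symm_apply_le]
      exact Fin.le_last _
    exact (hy z).trans this

namespace Spine

variable (A : Spine L m)

lemma exists_eq_sup {x y : L} (h : ¬ x ≤ y) (h' : ¬ y ≤ x) : ∃ a, A.r a = x ⊔ y :=
  (A.isReducible_iff _).1 (.inl ⟨x, y, fun h1 => h' (h1 ▸ le_sup_right),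
    fun h1 => h (h1 ▸ le_sup_left), rfl⟩)

lemma exists_eq_inf {x y : L} (h : ¬ x ≤ y) (h' : ¬ y ≤ x) : ∃ a, A.r a = x ⊓ y :=
  (A.isReducible_iff _).1 (.inr ⟨x, y, fun h1 => h (h1 ▸ inf_le_right),
    fun h1 => h' (h1 ▸ inf_le_left), rfl⟩)

lemma exists_lo (x : L) : ∃ b, ∀ a, A.r a ≤ x ↔ a ≤ b := by
  classical
  let F : Finset (Fin (m + 1)) := Finset.univ.filter fun a => A.r a ≤ x
  have hF : F.Nonempty := ⟨0, by simp [F, A.r_zero_le]⟩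
  refine ⟨F.max' hF, fun a => ⟨fun h => F.le_max' _ (by simp [F, h]), fun h => ?_⟩⟩
  have : F.max' hF ∈ F := F.max'_mem hF
  simp only [F, Finset.mem_filter, Finset.mem_univ, true_and] at this
  exact (A.strictMono.monotone h).trans this

/-- The number of the largest reducible element below `x`. -/
noncomputable def lo (x : L) : Fin (m + 1) := (A.exists_lo x).choose

lemma r_le_iff {a : Fin (m + 1)} {x : L} : A.r a ≤ x ↔ a ≤ A.lo x := (A.exists_lo x).choose_spec a

/-- There is no reducible element between `y` and `z`. -/
def NoRed (y z : L) : Prop := ∀ c, y ≤ A.r c → ¬ A.r c ≤ z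

variable {A}

/-- If w and z were incomparable, their meet would be a reducible element between y and z. This is
where the shape of the lattice is forced. -/
lemma NoRed.total_of_le_left {y z w : L} (h : A.NoRed y z) (hyz : y ≤ z) (hw : y ≤ w) :
    z ≤ w ∨ w ≤ z := by
  by_contra! h'
  obtain ⟨a, ha⟩ := A.exists_eq_inf h'.1 h'.2
  exact h a (ha ▸ le_inf hyz hw) (ha ▸ inf_le_left)

lemma NoRed.total_of_le_right {y z w : L} (h : A.NoRed y z) (hyz : y ≤ z) (hw : w ≤ z) :
    y ≤ w ∨ w ≤ y := by
  by_contra! h'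
  obtain ⟨a, ha⟩ := A.exists_eq_sup h'.1 h'.2
  exact h a (ha ▸ le_sup_left) (ha ▸ sup_le hyz hw)

lemma NoRed.lt_r {y z : L} (h : A.NoRed y z) (hyz : y ≤ z) {b : Fin (m + 1)} (hb : y ≤ A.r b) :
    z < A.r b :=
  lt_of_le_not_ge ((h.total_of_le_left hyz hb).resolve_right (h b hb)) (h b hb)

lemma NoRed.r_lt {y z : L} (h : A.NoRed y z) (hyz : y ≤ z) {b : Fin (m + 1)} (hb : A.r b ≤ z) :
    A.r b < y :=
  lt_of_le_not_ge ((h.total_of_le_right hyz hb).resolve_left fun h' => h b h' hb)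
    fun h' => h b h' hb

variable (A)

/-- Slots correspond to the coverings with reducible upper element. -/
abbrev Slot : Type := {p : L × Fin (m + 1) // p.1 ⋖ A.r p.2}

/-- The elements of a slot. -/
def slotSet (k : A.Slot) : Set L := {y | A.r (A.lo k.1.1) < y ∧ y ≤ k.1.1}

variable {A}

lemma mem_slotSet_iff {k : A.Slot} {y : L} :
    y ∈ A.slotSet k ↔ y ≤ k.1.1 ∧ A.NoRed y k.1.1 := by
  constructor
  · rintro ⟨h1, h2⟩
    refine ⟨h2, fun c hc hc' => ?_⟩
    exact (h1.trans_le (hc.trans (A.strictMono.monotone (A.r_le_iff.1 hc')))).false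
  · rintro ⟨h1, h2⟩
    exact ⟨h2.r_lt h1 (A.r_le_iff.2 le_rfl), h1⟩

/-- Take the least reducible element r above y and a lower cover x of r with y ≤ x. Minimality of r
leaves no reducible element between y and x. -/
lemma exists_mem_slotSet [Finite L] {y : L} (hy : ∀ a, A.r a ≠ y) : ∃ k, y ∈ A.slotSet k := by
  classical
  let F : Finset (Fin (m + 1)) := Finset.univ.filter fun a => y ≤ A.r a
  have hF : F.Nonempty := ⟨Fin.last m, by simp [F, A.le_r_last]⟩
  have h1 : F.min' hF ∈ F := F.min'_mem hF
  have h2 : ∀ c, y ≤ A.r c → F.min' hF ≤ c := fun c hc => F.min'_le _ (by simp [F, hc])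
  simp only [F, Finset.mem_filter, Finset.mem_univ, true_and] at h1
  obtain ⟨x, hx, hx'⟩ := exists_le_covBy_of_lt (lt_of_le_of_ne h1 (hy _).symm)
  refine ⟨⟨(x, _), hx'⟩, mem_slotSet_iff.2 ⟨hx, fun c hc hc' => ?_⟩⟩
  exact (h2 c hc).not_gt (A.strictMono.lt_iff_lt.1 (lt_of_le_of_lt hc' hx'.lt))

/-- The tops of the two slots are comparable, both being above y with no reducible element in
between. The higher top is still below the reducible element covering the lower one, so the tops
coincide, and then so do the reducible elements covering them. -/
lemma slot_unique {k k' : A.Slot} {y : L} (h : y ∈ A.slotSet k) (h' : y ∈ A.slotSet k') :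
    k = k' := by
  rw [mem_slotSet_iff] at h h'
  wlog hle : k.1.1 ≤ k'.1.1 generalizing k k' with H
  · exact (H h' h ((h.2.total_of_le_left h.1 h'.1).resolve_left hle)).symm
  have h1 : k'.1.1 < A.r k.1.2 := h'.2.lt_r h'.1 (h.1.trans k.2.le)
  have h2 : k.1.1 = k'.1.1 := by
    by_contra hne
    exact k.2.2 (lt_of_le_of_ne hle hne) h1
  have h3 : A.r k.1.2 = A.r k'.1.2 := by
    have h4 := k'.2
    rw [← h2] at h4
    rcases le_total k.1.2 k'.1.2 with h5 | h5
    · exact (h4.eq_or_eq k.2.le (A.strictMono.monotone h5)).resolve_left k.2.lt.ne'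
    · exact ((k.2.eq_or_eq h4.le (A.strictMono.monotone h5)).resolve_left h4.lt.ne').symm
  exact Subtype.ext (Prod.ext h2 (A.strictMono.injective h3))

lemma isChain_slotSet (k : A.Slot) : IsChain (· ≤ ·) (A.slotSet k) := by
  intro y hy z hz _
  rw [mem_slotSet_iff] at hy hz
  exact hy.2.total_of_le_right hy.1 hz.1

lemma r_le_iff_of_mem {k : A.Slot} {y : L} (hy : y ∈ A.slotSet k) {a : Fin (m + 1)} :
    A.r a ≤ y ↔ a ≤ A.lo k.1.1 :=
  ⟨fun h => A.r_le_iff.1 (h.trans hy.2), fun h => (A.strictMono.monotone h).trans hy.1.le⟩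

lemma le_r_iff_of_mem {k : A.Slot} {y : L} (hy : y ∈ A.slotSet k) {b : Fin (m + 1)} :
    y ≤ A.r b ↔ k.1.2 ≤ b := by
  rw [mem_slotSet_iff] at hy
  refine ⟨fun h => ?_, fun h => hy.1.trans (k.2.le.trans (A.strictMono.monotone h))⟩
  by_contra! hb
  exact k.2.2 (hy.2.lt_r hy.1 h) (A.strictMono hb)

/-- Either no reducible element lies between y and z, and then they share a slot, or one does and it
separates the two slots. This is the order of the model. -/
lemma eq_or_le_of_le {k k' : A.Slot} {y z : L} (hy : y ∈ A.slotSet k) (hz : z ∈ A.slotSet k')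
    (hyz : y ≤ z) : k = k' ∨ k.1.2 ≤ A.lo k'.1.1 := by
  by_cases h : A.NoRed y z
  · left
    refine slot_unique hy (mem_slotSet_iff.2 ⟨hyz.trans hz.2, fun c hc hc' => ?_⟩)
    exact (mem_slotSet_iff.1 hz).2 c (h.lt_r hyz hc).le hc'
  · right
    unfold NoRed at h
    push Not at h
    obtain ⟨c, h1, h2⟩ := h
    exact ((le_r_iff_of_mem hy).1 h1).trans ((r_le_iff_of_mem hz).1 h2)

variable [Finite L]

variable (A) in
/-- The slot data of a lattice whose reducible elements form a chain. -/
noncomputable def slotData : SlotData m A.Slot where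
  s k := A.lo k.1.1
  t k := k.1.2
  n k := (A.slotSet k).ncard
  lt k := A.strictMono.lt_iff_lt.1 (lt_of_le_of_lt (A.r_le_iff.2 le_rfl) k.2.lt)
  gap a := by
    obtain ⟨x, hx, hx'⟩ := exists_le_covBy_of_lt (A.strictMono (Fin.castSucc_lt_succ (i := a)))
    refine ⟨⟨(x, a.succ), hx'⟩, le_antisymm ?_ (A.r_le_iff.1 hx), rfl⟩
    have : A.lo x < a.succ :=
      A.strictMono.lt_iff_lt.1 (lt_of_le_of_lt (A.r_le_iff.2 le_rfl) hx'.lt)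
    exact Fin.le_castSucc_iff.2 this
  simple_of_zero k hk := by
    rw [Set.ncard_eq_zero, Set.eq_empty_iff_forall_notMem] at hk
    -- An empty slot comes from a covering between two reducible elements. These must then be
    -- consecutive, and the top of another slot with the same ends would lie strictly between them.
    have h1 : A.r (A.lo k.1.1) = k.1.1 := by
      refine (A.r_le_iff.2 le_rfl).eq_or_lt.resolve_right fun h => hk k.1.1 ⟨h, le_rfl⟩
    have h2 := k.2
    rw [← h1] at h2
    have h3 := A.strictMono.lt_iff_lt.1 h2.lt
    refine ⟨?_, fun k' hs ht => ?_⟩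
    · by_contra hne
      have h4 : (A.lo k.1.1 : ℕ) + 1 < k.1.2 := by
        have := Fin.lt_def.1 h3
        omega
      have h5 : (A.lo k.1.1 : ℕ) + 1 < m + 1 := by omega
      exact h2.2 (c := A.r ⟨_, h5⟩) (A.strictMono (Fin.lt_def.2 (Nat.lt_succ_self _)))
        (A.strictMono (Fin.lt_def.2 h4))
    · have h4 : k.1.1 ≤ k'.1.1 := by
        rw [← h1]
        exact A.r_le_iff.2 hs.ge
      have h5 := k'.2
      rw [ht] at h5
      refine (Subtype.ext (Prod.ext ?_ ht.symm)).symm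
      by_contra hne
      exact k.2.2 (lt_of_le_of_ne h4 hne) h5.lt

variable (A) in
/-- The increasing enumeration of a slot. -/
noncomputable def slotEnum (k : A.Slot) : Fin (A.slotData.n k) ≃o A.slotSet k :=
  Classical.choice (exists_orderIso_fin_of_isChain (isChain_slotSet k))

variable (A) in
/-- The element of the lattice described by an element of the model. -/
noncomputable def ofPt : A.slotData.Pt → L
  | .red a => A.r a
  | .irr k i h => A.slotEnum k ⟨i, h⟩

open SlotData in
lemma ofPt_le_iff {x y : A.slotData.Pt} : A.ofPt x ≤ A.ofPt y ↔ x ≤ y := by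
  rcases x with a | ⟨k, i, h⟩ <;> rcases y with b | ⟨k', i', h'⟩
  · rw [Pt.red_le_red]
    exact A.strictMono.le_iff_le
  · rw [Pt.red_le_irr]
    exact r_le_iff_of_mem (A.slotEnum k' _).2
  · rw [Pt.irr_le_red]
    exact le_r_iff_of_mem (A.slotEnum k _).2
  · rw [Pt.irr_le_irr]
    constructor
    · intro hle
      rcases eq_or_le_of_le (A.slotEnum k _).2 (A.slotEnum k' _).2 hle with rfl | h1
      · exact .inr ⟨rfl, (A.slotEnum k).le_iff_le.1 hle⟩
      · exact .inl h1
    · rintro (h1 | ⟨rfl, h1⟩)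
      · exact ((le_r_iff_of_mem (A.slotEnum k _).2).2 le_rfl).trans
          ((r_le_iff_of_mem (A.slotEnum k' _).2).2 h1)
      · exact (A.slotEnum k).le_iff_le.2 h1

lemma ofPt_surjective : Function.Surjective A.ofPt := by
  intro y
  by_cases h : ∀ a, A.r a ≠ y
  · obtain ⟨k, hk⟩ := exists_mem_slotSet h
    let i := (A.slotEnum k).symm ⟨y, hk⟩
    refine ⟨.irr k i i.2, ?_⟩
    have : A.slotEnum k i = ⟨y, hk⟩ := (A.slotEnum k).apply_symm_apply _
    exact congrArg Subtype.val this
  · push Not at h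
    obtain ⟨a, rfl⟩ := h
    exact ⟨.red a, rfl⟩

variable (A) in
/-- A finite lattice whose reducible elements form a chain is described by its slot data. -/
noncomputable def orderIso : A.slotData.Pt ≃o L :=
  RelIso.ofSurjective (OrderEmbedding.ofMapLEIff A.ofPt fun _ _ => ofPt_le_iff) ofPt_surjective

end Spine

end Decomposition

namespace SlotData

/-- The map of posets induced by a renumbering of the slots. -/
def ptMap {m : ℕ} {K K' : Type} {D : SlotData m K} {D' : SlotData m K'} (e : K → K')
    (hn : ∀ k, D'.n (e k) = D.n k) : D.Pt → D'.Pt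
  | .red a => .red a
  | .irr k i h => .irr (e k) i (by rwa [hn])

/-- Slot data that agree up to a renumbering of the slots describe isomorphic posets. -/
lemma nonempty_ptOrderIso {m : ℕ} {K K' : Type} {D : SlotData m K} {D' : SlotData m K'}
    (e : K ≃ K') (hs : ∀ k, D'.s (e k) = D.s k) (ht : ∀ k, D'.t (e k) = D.t k)
    (hn : ∀ k, D'.n (e k) = D.n k) : Nonempty (D.Pt ≃o D'.Pt) := by
  refine ⟨RelIso.ofSurjective (OrderEmbedding.ofMapLEIff (ptMap e hn) fun x y => ?_) fun y => ?_⟩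
  · rcases x with a | ⟨k, i, h⟩ <;> rcases y with b | ⟨k', i', h'⟩ <;> simp [ptMap, hs, ht]
  · rcases y with a | ⟨k, i, h⟩
    · exact ⟨.red a, rfl⟩
    · obtain ⟨k, rfl⟩ := e.surjective k
      exact ⟨.irr k i (by rwa [← hn]), rfl⟩

end SlotData

/-! ### The twelve shapes -/

/-- The pair of consecutive elements number `a` and `a + 1` of a five-element chain. -/
def gapPair (a : Fin 4) : Fin 5 × Fin 5 := (a.castSucc, a.succ)

/-- The gap of the main chain that contains two slots. -/
def doubledGap : Fin 12 → Fin 4 := ![1, 2, 3, 3, 1, 1, 1, 2, 2, 2, 0, 0]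

/-- The ends of the first slot that does not lie in a gap of the main chain. -/
def firstEar : Fin 12 → Fin 5 × Fin 5 :=
  ![(0, 3), (0, 4), (0, 2), (0, 2), (0, 3), (0, 3), (0, 4), (0, 4), (0, 2), (0, 3), (0, 3), (1, 3)]

/-- The ends of the second slot that does not lie in a gap of the main chain. -/
def secondEar : Fin 12 → Fin 5 × Fin 5 :=
  ![(0, 4), (1, 4), (1, 3), (1, 4), (1, 4), (2, 4), (1, 3), (1, 3), (1, 4), (1, 4), (2, 4), (2, 4)]

/-- The ends of the seven slots: two in the doubled gap, two not in a gap of the main chain, and one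
in each of the other gaps. -/
def shape (g : Fin 12) : Fin 7 → Fin 5 × Fin 5 :=
  ![gapPair (doubledGap g), gapPair (doubledGap g), firstEar g, secondEar g,
    gapPair ((doubledGap g).succAbove 0), gapPair ((doubledGap g).succAbove 1),
    gapPair ((doubledGap g).succAbove 2)]

lemma shape_lt : ∀ g k, (shape g k).1 < (shape g k).2 := by decide

lemma exists_shape_eq_gapPair : ∀ g a, ∃ k, shape g k = gapPair a := by decide

/-- The slot `k` of the shape `g` is the only one in its gap. -/
def ShapeSimple (g : Fin 12) (k : Fin 7) : Prop :=
  ((shape g k).2 : ℕ) = (shape g k).1 + 1 ∧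
    ∀ k', (shape g k').1 = (shape g k).1 → (shape g k').2 = (shape g k).2 → k' = k

instance (g : Fin 12) (k : Fin 7) : Decidable (ShapeSimple g k) :=
  inferInstanceAs (Decidable (_ ∧ _))

/-- Slots 0 and 1 share the doubled gap and slots 2 and 3 skip a main chain element; the other three
are alone in their gaps. -/
lemma shapeSimple_iff : ∀ g k, ShapeSimple g k ↔ 4 ≤ k := by decide

lemma exists_shapeSimple_iff : ∀ g c,
    (∃ k, (shape g k).1 = c.castSucc ∧ (shape g k).2 = c.succ ∧ ShapeSimple g k) ↔
      c ≠ doubledGap g := by decide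

lemma shape_branching : ∀ g a,
    (∃ k k', k ≠ k' ∧ (shape g k).2 = a ∧ (shape g k').2 = a) ∨
      (∃ k k', k ≠ k' ∧ (shape g k).1 = a ∧ (shape g k').1 = a) := by decide

/-- The conditions on the sizes of the seven slots: only the slots that are alone in a gap may be
empty, and of the two slots in the doubled gap the smaller one comes first. -/
structure AreSizes (n : Fin 7 → ℕ) : Prop where
  pos : 1 ≤ n 0
  le : n 0 ≤ n 1
  first_pos : 1 ≤ n 2
  second_pos : 1 ≤ n 3

/-- The slot data with given shape and sizes. -/
def shapeData (g : Fin 12) (n : Fin 7 → ℕ) (hn : AreSizes n) : SlotData 4 (Fin 7) where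
  s k := (shape g k).1
  t k := (shape g k).2
  n := n
  lt := shape_lt g
  gap a := by
    obtain ⟨k, hk⟩ := exists_shape_eq_gapPair g a
    exact ⟨k, by rw [hk]; rfl, by rw [hk]; rfl⟩
  simple_of_zero k hk := by
    refine (shapeSimple_iff g k).2 ?_
    obtain ⟨h0, h1, h2, h3⟩ := hn
    by_contra! h
    have : k = 0 ∨ k = 1 ∨ k = 2 ∨ k = 3 := by
      clear hk
      revert k
      decide
    rcases this with rfl | rfl | rfl | rfl <;> omega

lemma isBlockOfType_shapeData (g : Fin 12) (n : Fin 7 → ℕ) (hn : AreSizes n) :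
    IsBlockOfType (shapeData g n hn).Pt 5 3 5 := by
  refine (SlotData.Pt.isBlockOfType_iff 3 5).2 ⟨shape_branching g, by simp, ?_⟩
  have : ∀ c, SlotData.Pt.gapLength (shapeData g n hn) c = if c ≠ doubledGap g then 1 else 2 :=
    fun c => by
      by_cases h : c ≠ doubledGap g
      · exact (if_pos ((exists_shapeSimple_iff g c).2 h)).trans (if_pos h).symm
      · exact (if_neg (mt (exists_shapeSimple_iff g c).1 h)).trans (if_neg h).symm
  simp only [this]
  have h : ∀ g : Fin 12, ∑ c, (if c ≠ doubledGap g then 1 else 2) = 5 := by decide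
  exact h g

/-! ### Classification of the ears -/

/-- Three ears touch all elements of a five-element chain and exactly one of them lies in a gap. -/
def AreEars (p q r : Fin 5 × Fin 5) : Prop :=
  (∀ a, p.1 = a ∨ p.2 = a ∨ q.1 = a ∨ q.2 = a ∨ r.1 = a ∨ r.2 = a) ∧
    (∑ c : Fin 4, if p = gapPair c ∨ q = gapPair c ∨ r = gapPair c then 2 else 1) = 5

instance (p q r : Fin 5 × Fin 5) : Decidable (AreEars p q r) :=
  inferInstanceAs (Decidable (_ ∧ _))

/-- A finite check over the 10 possible ears in each of three places; the permutation moves the ear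
lying in a gap to the front and orders the other two as in the tables. -/
lemma exists_shape_of_areEars : ∀ p : Fin 5 × Fin 5, p.1 < p.2 → ∀ q : Fin 5 × Fin 5, q.1 < q.2 →
    ∀ r : Fin 5 × Fin 5, r.1 < r.2 → AreEars p q r → ∃ g, ∃ σ : Equiv.Perm (Fin 3),
      ∀ i, ![p, q, r] (σ i) = ![gapPair (doubledGap g), firstEar g, secondEar g] i := by
  decide +kernel


/-- The place of the seven slots of a shape among four slots in gaps and three ears. -/
def slotPlace (a : Fin 4) : Fin 7 → Fin 4 ⊕ Fin 3 :=
  ![.inl a, .inr 0, .inr 1, .inr 2, .inl (a.succAbove 0), .inl (a.succAbove 1),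
    .inl (a.succAbove 2)]

lemma slotPlace_bijective : ∀ a, Function.Bijective (slotPlace a) := by decide

lemma shape_eq_elim_slotPlace : ∀ g k, shape g k =
    Sum.elim gapPair ![gapPair (doubledGap g), firstEar g, secondEar g]
      (slotPlace (doubledGap g) k) := by decide

/-- Slot data with seven slots that contain a slot in each gap extend to a numbering of the slots by
gaps and ears. -/
lemma exists_equiv_gaps_ears {K : Type} [Fintype K] (D : SlotData 4 K) (hK : Fintype.card K = 7) :
    ∃ e : Fin 4 ⊕ Fin 3 ≃ K, ∀ a, D.s (e (.inl a)) = a.castSucc ∧ D.t (e (.inl a)) = a.succ := by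
  classical
  choose b hb using D.gap
  have hinj : Function.Injective b := fun x y h => by
    have := (hb x).1
    rw [h, (hb y).1] at this
    exact (Fin.castSucc_injective _ this).symm
  have hc : Fintype.card ↥(Set.range b)ᶜ = 3 := by
    rw [Fintype.card_compl_set, hK, Set.card_range_of_injective hinj]
    rfl
  let e' : Fin 3 ≃ ↥(Set.range b)ᶜ := (Fintype.equivFinOfCardEq hc).symm
  exact ⟨((Equiv.ofInjective b hinj).sumCongr e').trans (Equiv.Set.sumCompl _), fun a => hb a⟩

lemma exists_shape_of_slotData {K : Type} [Fintype K] (D : SlotData 4 K)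
    (hD : ∀ a, SlotData.Pt.Branching D a) (hK : Fintype.card K = 7)
    (hh : ∑ c, SlotData.Pt.gapLength D c = 5) :
    ∃ g, ∃ e : Fin 7 ≃ K, ∀ k, (D.s (e k), D.t (e k)) = shape g k := by
  obtain ⟨e, he⟩ := exists_equiv_gaps_ears D hK
  let ear : Fin 3 → Fin 5 × Fin 5 := fun i => (D.s (e (.inr i)), D.t (e (.inr i)))
  have hforall : ∀ f : Fin 3 → Prop, (∃ i, f i) → f 0 ∨ f 1 ∨ f 2 := by
    rintro f ⟨i, hi⟩
    fin_cases i <;> simp_all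
  have hears : AreEars (ear 0) (ear 1) (ear 2) := by
    constructor
    · intro a
      have key : ∃ i, (ear i).1 = a ∨ (ear i).2 = a := by
        -- The four gap slots alone have at most one start and one end at each element, so one of
        -- the two slots meeting at a is an ear.
        rcases hD a with ⟨k, k', hne, hk, hk'⟩ | ⟨k, k', hne, hk, hk'⟩
        · obtain ⟨x, rfl⟩ := e.surjective k
          obtain ⟨y, rfl⟩ := e.surjective k'
          rcases x with x | x
          · rcases y with y | y
            · rw [(he x).2] at hk
              rw [(he y).2] at hk'
              exact absurd (by rw [Fin.succ_injective _ (hk.trans hk'.symm)]) hne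
            · exact ⟨y, .inr hk'⟩
          · exact ⟨x, .inr hk⟩
        · obtain ⟨x, rfl⟩ := e.surjective k
          obtain ⟨y, rfl⟩ := e.surjective k'
          rcases x with x | x
          · rcases y with y | y
            · rw [(he x).1] at hk
              rw [(he y).1] at hk'
              exact absurd (by rw [Fin.castSucc_injective _ (hk.trans hk'.symm)]) hne
            · exact ⟨y, .inl hk'⟩
          · exact ⟨x, .inl hk⟩
      have := hforall _ key
      tauto
    -- Termwise comparison: a gap contributes 2 exactly when some ear lies in it, i.e. when its slot
    -- is not simple.
    · refine Eq.trans (Finset.sum_congr rfl fun c _ => ?_) hh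
      unfold SlotData.Pt.gapLength
      split_ifs with h1 h2 h2
      · exfalso
        obtain ⟨k, hs, ht, hk⟩ := h2
        have h3 : k = e (.inl c) := (hk.2 _ ((he c).1.trans hs.symm) ((he c).2.trans ht.symm)).symm
        have h4 : ∃ i, ear i = gapPair c := by tauto
        obtain ⟨i, hi⟩ := h4
        have h5 : e (.inr i) = k := hk.2 _ ((congrArg Prod.fst hi).trans hs.symm)
          ((congrArg Prod.snd hi).trans ht.symm)
        have := e.injective (h5.trans h3)
        cases this
      · rfl
      · rfl
      · exfalso
        refine h2 ⟨e (.inl c), (he c).1, (he c).2, ?_, fun k' hs ht => ?_⟩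
        · rw [(he c).1, (he c).2]
          simp
        · obtain ⟨x, rfl⟩ := e.surjective k'
          rcases x with x | x
          · rw [(he c).1, (he x).1] at hs
            rw [Fin.castSucc_injective _ hs]
          · exfalso
            refine h1 (hforall (fun i => ear i = gapPair c) ⟨x, ?_⟩)
            rw [(he c).1] at hs
            rw [(he c).2] at ht
            exact Prod.ext hs ht
  obtain ⟨g, σ, hg⟩ := exists_shape_of_areEars _ (D.lt _) _ (D.lt _) _ (D.lt _) hears
  refine ⟨g, (Equiv.ofBijective _ (slotPlace_bijective (doubledGap g))).trans
    (((Equiv.refl _).sumCongr σ).trans e), fun k => ?_⟩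
  rw [shape_eq_elim_slotPlace]
  simp only [Equiv.trans_apply, Equiv.ofBijective_apply]
  rcases slotPlace (doubledGap g) k with x | x
  · simp [he x, gapPair]
  · rw [Sum.elim_inr, ← hg x]
    simp only [Equiv.sumCongr_apply, Sum.map_inr]
    generalize σ x = y
    fin_cases y <;> rfl

lemma shape_swap (g : Fin 12) (k : Fin 7) : shape g (Equiv.swap 0 1 k) = shape g k := by
  revert g k
  decide

/-- The shape and the sizes of slot data. -/
lemma exists_shapeData_of_slotData {K : Type} [Fintype K] (D : SlotData 4 K)
    (hD : ∀ a, SlotData.Pt.Branching D a) (hK : Fintype.card K = 7)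
    (hh : ∑ c, SlotData.Pt.gapLength D c = 5) :
    ∃ g n, ∃ hn : AreSizes n, Nonempty ((shapeData g n hn).Pt ≃o D.Pt) := by
  obtain ⟨g, e, he⟩ := exists_shape_of_slotData D hD hK hh
  have hpos : ∀ k : Fin 7, k < 4 → 1 ≤ D.n (e k) := by
    intro k hk
    by_contra! h0
    have h1 := D.simple_of_zero (e k) (by omega)
    refine hk.not_ge ((shapeSimple_iff g k).1 ⟨?_, fun k' hs ht => ?_⟩)
    · rw [← he k]
      exact h1.1
    · rw [← he k, ← he k'] at hs ht
      exact e.injective (h1.2 _ hs ht)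
  have key : ∀ e : Fin 7 ≃ K, (∀ k, (D.s (e k), D.t (e k)) = shape g k) →
      AreSizes (fun k => D.n (e k)) →
      ∃ g n, ∃ hn : AreSizes n, Nonempty ((shapeData g n hn).Pt ≃o D.Pt) := by
    intro e he hn
    refine ⟨g, _, hn, SlotData.nonempty_ptOrderIso e (fun k => ?_) (fun k => ?_) fun k => rfl⟩
    · exact congrArg Prod.fst (he k)
    · exact congrArg Prod.snd (he k)
  -- The two slots of the doubled gap are interchangeable, so the smaller one can be put first.
  rcases le_total (D.n (e 0)) (D.n (e 1)) with hle | hle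
  · exact key e he ⟨hpos 0 (by decide), hle, hpos 2 (by decide), hpos 3 (by decide)⟩
  · refine key ((Equiv.swap 0 1).trans e) (fun k => ?_) ⟨hpos 1 (by decide), hle,
      hpos 2 (by decide), hpos 3 (by decide)⟩
    rw [← shape_swap, ← he]
    rfl

theorem exists_shapeData_of_isBlockOfType {L : Type} [Lattice L] [Finite L]
    (hL : IsBlockOfType L 5 3 5) :
    ∃ g n, ∃ hn : AreSizes n, Nonempty ((shapeData g n hn).Pt ≃o L) := by
  obtain ⟨A⟩ := exists_spine (m := 4) hL.1 hL.2.1 hL.2.2.1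
  have := Fintype.ofFinite A.Slot
  obtain ⟨h1, h2, h3⟩ :=
    (SlotData.Pt.isBlockOfType_iff 3 5).1 (hL.of_orderIso A.orderIso.symm)
  obtain ⟨g, n, hn, ⟨e⟩⟩ := exists_shapeData_of_slotData _ h1 h2 h3
  exact ⟨g, n, hn, ⟨e.trans A.orderIso⟩⟩

namespace SlotData

namespace Pt

variable {m : ℕ} {K K' : Type} {D : SlotData m K} {D' : SlotData m K'}

/-! ### Invariants of slot data -/

/-- The isomorphism permutes reducible elements, hence induces a strictly increasing self-map of
`Fin (m + 1)`, which never decreases its argument. Applied to the inverse as well, this shows that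
every main chain element is fixed. -/
lemma le_red_of_orderIso (hD : ∀ a, Branching D a) (φ : D.Pt ≃o D'.Pt) (a : Fin (m + 1)) :
    red a ≤ φ (red a) ∧ ∃ b, φ (red a) = red b := by
  have h : ∀ a, ∃ b, φ (red a) = red b := fun a =>
    isReducible_iff_red ((isReducible_apply_iff φ).2 (isReducible_red_iff.2 (hD a)))
  choose f hf using h
  have hmono : StrictMono f := fun a b hab => by
    have := φ.lt_iff_lt.2 (red_lt_red (D := D).2 hab)
    rwa [hf, hf, red_lt_red] at this
  exact ⟨by rw [hf, red_le_red]; exact hmono.le_apply, _, hf a⟩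

lemma orderIso_red (hD : ∀ a, Branching D a) (hD' : ∀ a, Branching D' a) (φ : D.Pt ≃o D'.Pt)
    (a : Fin (m + 1)) : φ (red a) = red a := by
  obtain ⟨h1, b, hb⟩ := le_red_of_orderIso hD φ a
  obtain ⟨h2, -⟩ := le_red_of_orderIso hD' φ.symm b
  rw [← hb, φ.symm_apply_apply] at h2
  replace h2 := red_le_red.1 h2
  rw [hb, red_le_red] at h1
  rw [hb, le_antisymm h1 h2]

lemma lo_orderIso (hD : ∀ a, Branching D a) (hD' : ∀ a, Branching D' a) (φ : D.Pt ≃o D'.Pt)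
    (x : D.Pt) : (φ x).lo = x.lo :=
  eq_of_forall_le_iff fun a => by
    rw [← red_le_iff, ← red_le_iff, ← orderIso_red hD hD' φ a, φ.le_iff_le]

lemma hi_orderIso (hD : ∀ a, Branching D a) (hD' : ∀ a, Branching D' a) (φ : D.Pt ≃o D'.Pt)
    (x : D.Pt) : (φ x).hi = x.hi :=
  eq_of_forall_ge_iff fun a => by
    rw [← le_red_iff, ← le_red_iff, ← orderIso_red hD hD' φ a, φ.le_iff_le]

/-- The elements of the slots between the elements number `p.1` and `p.2` of the main chain. -/
def Region (D : SlotData m K) (p : Fin (m + 1) × Fin (m + 1)) : Type :=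
  {x : D.Pt // x.lo = p.1 ∧ x.hi = p.2}

/-- The comparable pairs of elements of slots between the elements number `p.1` and `p.2` of the
main chain. -/
def RegionPair (D : SlotData m K) (p : Fin (m + 1) × Fin (m + 1)) : Type :=
  {x : Region D p × Region D p // x.1.1 ≤ x.2.1 ∨ x.2.1 ≤ x.1.1}

lemma natCard_region [Fintype K] {p : Fin (m + 1) × Fin (m + 1)} (hp : p.1 < p.2) :
    Nat.card (Region D p) = ∑ k with (D.s k, D.t k) = p, D.n k := by
  let f : (Σ k : {k // (D.s k, D.t k) = p}, Fin (D.n k)) → Region D p := fun x =>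
    ⟨irr x.1 x.2 x.2.2, congrArg Prod.fst x.1.2, congrArg Prod.snd x.1.2⟩
  have hf : Function.Bijective f := by
    constructor
    · rintro ⟨⟨k, hk⟩, i⟩ ⟨⟨k', hk'⟩, i'⟩ h
      obtain ⟨rfl, h2⟩ := irr.inj (congrArg Subtype.val h)
      obtain rfl := Fin.ext h2
      rfl
    · rintro ⟨x, hx⟩
      rcases x with a | ⟨k, i, h⟩
      · exact absurd (hx.1.symm.trans hx.2) hp.ne
      · exact ⟨⟨⟨k, Prod.ext hx.1 hx.2⟩, ⟨i, h⟩⟩, rfl⟩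
  rw [← Nat.card_eq_of_bijective f hf, Nat.card_eq_fintype_card, Fintype.card_sigma]
  simp only [Fintype.card_fin]
  exact (Finset.sum_subtype _ (by simp) _).symm

/-- Elements of different slots with the same ends are incomparable, so each slot contributes all
ordered pairs of its own elements. The sum of squares tells apart what the sum of sizes cannot: how
the elements of a region are split into slots. -/
lemma natCard_regionPair [Fintype K] {p : Fin (m + 1) × Fin (m + 1)} (hp : p.1 < p.2) :
    Nat.card (RegionPair D p) = ∑ k with (D.s k, D.t k) = p, D.n k * D.n k := by
  let f : (Σ k : {k // (D.s k, D.t k) = p}, Fin (D.n k) × Fin (D.n k)) → RegionPair D p := fun x =>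
    ⟨(⟨irr x.1 x.2.1 x.2.1.2, congrArg Prod.fst x.1.2, congrArg Prod.snd x.1.2⟩,
      ⟨irr x.1 x.2.2 x.2.2.2, congrArg Prod.fst x.1.2, congrArg Prod.snd x.1.2⟩),
      (le_total x.2.1 x.2.2).imp (fun h => .inr ⟨rfl, h⟩) fun h => .inr ⟨rfl, h⟩⟩
  have hf : Function.Bijective f := by
    constructor
    · rintro ⟨⟨k, hk⟩, i, j⟩ ⟨⟨k', hk'⟩, i', j'⟩ h
      have h0 := congrArg Subtype.val h
      obtain ⟨rfl, h2⟩ := irr.inj (congrArg Subtype.val (congrArg Prod.fst h0))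
      obtain ⟨-, h3⟩ := irr.inj (congrArg Subtype.val (congrArg Prod.snd h0))
      obtain rfl := Fin.ext h2
      obtain rfl := Fin.ext h3
      rfl
    · rintro ⟨⟨⟨x, hx⟩, ⟨y, hy⟩⟩, hxy⟩
      rcases x with a | ⟨k, i, h⟩
      · exact absurd (hx.1.symm.trans hx.2) hp.ne
      rcases y with a | ⟨k', i', h'⟩
      · exact absurd (hy.1.symm.trans hy.2) hp.ne
      have hk : k = k' := by
        simp only [irr_le_irr] at hxy
        simp only [lo_irr, hi_irr] at hx hy
        grind
      subst hk
      exact ⟨⟨⟨k, Prod.ext hx.1 hx.2⟩, ⟨i, h⟩, ⟨i', h'⟩⟩, rfl⟩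
  rw [← Nat.card_eq_of_bijective f hf, Nat.card_eq_fintype_card, Fintype.card_sigma]
  simp only [Fintype.card_prod, Fintype.card_fin]
  exact (Finset.sum_subtype _ (by simp) fun k => D.n k * D.n k).symm

/-- Isomorphic models have regions of the same size with equally many comparable pairs. -/
lemma sum_eq_of_orderIso [Fintype K] [Fintype K'] (hD : ∀ a, Branching D a)
    (hD' : ∀ a, Branching D' a) (φ : D.Pt ≃o D'.Pt) {p : Fin (m + 1) × Fin (m + 1)}
    (hp : p.1 < p.2) :
    ∑ k with (D.s k, D.t k) = p, D.n k = ∑ k with (D'.s k, D'.t k) = p, D'.n k ∧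
      ∑ k with (D.s k, D.t k) = p, D.n k * D.n k =
        ∑ k with (D'.s k, D'.t k) = p, D'.n k * D'.n k := by
  let e : Region D p ≃ Region D' p := φ.toEquiv.subtypeEquiv fun x => by
    have h1 := lo_orderIso hD hD' φ x
    have h2 := hi_orderIso hD hD' φ x
    change _ ↔ (φ x).lo = p.1 ∧ (φ x).hi = p.2
    rw [h1, h2]
  let e' : RegionPair D p ≃ RegionPair D' p := (e.prodCongr e).subtypeEquiv fun x =>
    or_congr φ.le_iff_le.symm φ.le_iff_le.symm
  rw [← natCard_region hp, ← natCard_region hp, ← natCard_regionPair hp, ← natCard_regionPair hp]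
  exact ⟨Nat.card_congr e, Nat.card_congr e'⟩

end Pt

end SlotData

/-! ### Shape and sizes are isomorphism invariants -/

lemma filter_shape_eq_gapPair : ∀ g,
    (Finset.univ.filter fun k => shape g k = gapPair (doubledGap g)) = {0, 1} := by decide

lemma filter_shape_eq_shape : ∀ g k, 2 ≤ k →
    (Finset.univ.filter fun k' => shape g k' = shape g k) = {k} := by decide

lemma exists_shape_eq_of_ne : ∀ g c, c ≠ doubledGap g → ∃ k, 2 ≤ k ∧ shape g k = gapPair c := by
  decide

lemma eq_of_ears_mem : ∀ g g', doubledGap g = doubledGap g' → (∃ k, shape g' k = firstEar g) →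
    (∃ k, shape g' k = secondEar g) → g = g' := by decide

theorem eq_of_shapeData_orderIso {g g' : Fin 12} {n n' : Fin 7 → ℕ} {hn : AreSizes n}
    {hn' : AreSizes n'} (φ : (shapeData g n hn).Pt ≃o (shapeData g' n' hn').Pt) :
    g = g' ∧ n = n' := by
  have key : ∀ p : Fin 5 × Fin 5, p.1 < p.2 →
      ∑ k with shape g k = p, n k = ∑ k with shape g' k = p, n' k ∧
      ∑ k with shape g k = p, n k * n k = ∑ k with shape g' k = p, n' k * n' k := fun p hp =>
    SlotData.Pt.sum_eq_of_orderIso (shape_branching g) (shape_branching g') φ hp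
  have hgap : doubledGap g = doubledGap g' := by
    -- Otherwise two positive sizes in this gap for g would match a single slot for g', giving n 0 ^
    -- 2 + n 1 ^ 2 = (n 0 + n 1) ^ 2.
    by_contra hne
    obtain ⟨k, hk, hk'⟩ := exists_shape_eq_of_ne g' _ hne
    obtain ⟨h1, h2⟩ := key (gapPair (doubledGap g)) (shape_lt g 0)
    rw [filter_shape_eq_gapPair, ← hk', filter_shape_eq_shape g' k hk, Finset.sum_singleton,
      Finset.sum_pair (by decide)] at h1 h2
    rw [← h1] at h2
    have := hn.pos
    have := hn.le
    nlinarith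
  have hear : ∀ k, 2 ≤ k → 1 ≤ n k → ∃ k', shape g' k' = shape g k := by
    intro k hk hk1
    by_contra! hne
    have h1 := (key (shape g k) (shape_lt g k)).1
    rw [filter_shape_eq_shape g k hk, Finset.sum_singleton,
      Finset.filter_eq_empty_iff.2 fun k' _ => hne k', Finset.sum_empty] at h1
    omega
  obtain rfl := eq_of_ears_mem g g' hgap (hear 2 le_rfl hn.first_pos)
    (hear 3 (by decide) hn.second_pos)
  refine ⟨rfl, funext fun k => ?_⟩
  by_cases hk : 2 ≤ k
  · have h1 := (key (shape g k) (shape_lt g k)).1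
    rwa [filter_shape_eq_shape g k hk, Finset.sum_singleton, Finset.sum_singleton] at h1
  · obtain ⟨h1, h2⟩ := key (gapPair (doubledGap g)) (shape_lt g 0)
    rw [filter_shape_eq_gapPair, Finset.sum_pair (by decide), Finset.sum_pair (by decide)] at h1 h2
    have h3 := hn.le
    have h4 := hn'.le
    -- Equal sums and equal sums of squares determine an ordered pair.
    have h5 : n 0 = n' 0 := by
      rcases lt_trichotomy (n 0) (n' 0) with h | h | h
      · nlinarith
      · exact h
      · nlinarith
    have h6 : k = 0 ∨ k = 1 := by
      revert k
      decide
    rcases h6 with rfl | rfl <;> omega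

/-! ### Iterated sums -/

/-- The `k`-fold iterated sum of the sequence `f`. -/
def iterSum (f : ℕ → ℕ) : ℕ → ℕ → ℕ
  | 0 => f
  | k + 1 => fun N => ∑ u ∈ Finset.range N, iterSum f k u

lemma iterSum_succ (f : ℕ → ℕ) (k N : ℕ) :
    iterSum f (k + 1) N = ∑ u ∈ Finset.range N, iterSum f k u := rfl

lemma iterSum_iterSum (f : ℕ → ℕ) (k l : ℕ) : iterSum (iterSum f k) l = iterSum f (k + l) := by
  induction l with
  | zero => rfl
  | succ l ih =>
    funext N
    rw [iterSum_succ, ih]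
    rfl

/-- The ranges exclude their bound, so each summation lengthens the initial run of zeros by one. -/
lemma iterSum_eq_zero {f : ℕ → ℕ} {b : ℕ} (hf : ∀ u < b, f u = 0) (k : ℕ) :
    ∀ u < b + k, iterSum f k u = 0 := by
  induction k with
  | zero => exact hf
  | succ k ih =>
    intro u hu
    refine Finset.sum_eq_zero fun v hv => ih v ?_
    rw [Finset.mem_range] at hv
    omega

lemma iterSum_eq_sum_choose (f : ℕ → ℕ) (k N : ℕ) :
    iterSum f (k + 1) N = ∑ u ∈ Finset.range N, (N - 1 - u).choose k * f u := by
  induction k generalizing N with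
  | zero => simp [iterSum]
  | succ k ih =>
    induction N with
    | zero => rfl
    | succ N ihN =>
      rw [iterSum_succ, Finset.sum_range_succ, ← iterSum_succ, ihN, ih, ← Finset.sum_add_distrib,
        Finset.sum_range_succ]
      simp only [Nat.add_sub_cancel, Nat.sub_self, Nat.choose_zero_succ, zero_mul, add_zero]
      refine Finset.sum_congr rfl fun u hu => ?_
      rw [Finset.mem_range] at hu
      obtain ⟨d, rfl⟩ := Nat.exists_eq_add_of_lt hu
      rw [show u + d + 1 - 1 - u = d by omega, show u + d + 1 - u = d + 1 by omega,
        Nat.choose_succ_succ]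
      ring

/-- Substitution u = J - i - c. Terms with u < b - c can be added freely because f vanishes there;
the same vanishing, with c < b, kills the spurious terms that truncated subtraction produces when J
< b. -/
lemma sum_Icc_mul_sub (w f : ℕ → ℕ) (J a b c : ℕ) (hbc : c < b) (hf : ∀ u < b - c, f u = 0) :
    ∑ i ∈ Finset.Icc a (J - b), w i * f (J - i - c) =
      ∑ u ∈ Finset.range (J + 1 - a - c), w (J - c - u) * f u := by
  have h1 : ∑ u ∈ Finset.range (J + 1 - a - c), w (J - c - u) * f u =
      ∑ u ∈ Finset.Ico (b - c) (J + 1 - a - c), w (J - c - u) * f u := by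
    refine (Finset.sum_subset (fun u => ?_) fun u hu hu' => ?_).symm
    · simp only [Finset.mem_Ico, Finset.mem_range]
      omega
    · simp only [Finset.mem_Ico, Finset.mem_range] at hu hu'
      rw [hf u (by omega), mul_zero]
  rw [h1]
  by_cases hJ : J < b
  · rw [Finset.Ico_eq_empty (by omega), Finset.sum_empty]
    refine Finset.sum_eq_zero fun i hi => ?_
    rw [hf _ (by omega), mul_zero]
  · refine Finset.sum_nbij' (fun i => J - i - c) (fun u => J - c - u) ?_ ?_ ?_ ?_ ?_
    · intro i
      simp only [Finset.mem_Ico, Finset.mem_Icc]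
      omega
    · intro u
      simp only [Finset.mem_Ico, Finset.mem_Icc]
      omega
    · intro i
      simp only [Finset.mem_Icc]
      omega
    · intro u
      simp only [Finset.mem_Ico]
      omega
    · intro i hi
      simp only [Finset.mem_Icc] at hi
      rw [show J - c - (J - i - c) = i by omega]

lemma sum_Icc_sub (f : ℕ → ℕ) (J a b c : ℕ) (hbc : c < b) (hf : ∀ u < b - c, f u = 0) :
    ∑ i ∈ Finset.Icc a (J - b), f (J - i - c) = iterSum f 1 (J + 1 - a - c) := by
  have := sum_Icc_mul_sub (fun _ => 1) f J a b c hbc hf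
  simpa [iterSum] using this

/-- The weight i - 1 is a binomial coefficient `choose _ 1`, so such a sum is two plain summations
at once. -/
lemma sum_Icc_pred_mul_sub (f : ℕ → ℕ) (J b c : ℕ) (hbc : c < b) (hf : ∀ u < b - c, f u = 0) :
    ∑ i ∈ Finset.Icc 2 (J - b), (i - 1) * f (J - i - c) = iterSum f 2 (J - c) := by
  have h := sum_Icc_mul_sub (fun i => i - 1) f J 2 b c hbc hf
  rw [h, iterSum_eq_sum_choose]
  rcases Nat.eq_zero_or_pos (J - c) with h0 | h0
  · rw [h0, show J + 1 - 2 - c = 0 by omega]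
    rfl
  · rw [show J - c = (J + 1 - 2 - c) + 1 by omega, Finset.sum_range_succ]
    simp only [Nat.choose_one_right, Nat.add_sub_cancel, Nat.sub_self, zero_mul, add_zero]
    refine Finset.sum_congr rfl fun u _ => ?_
    rw [show J + 1 - 2 - c + 1 - u - 1 = J + 1 - 2 - c - u by omega]

/-- The four sums in the formula for the number of blocks, as iterated sums. -/
lemma sums_eq_iterSum (f : ℕ → ℕ) (hf : ∀ u < 2, f u = 0) (j : ℕ) :
    (∑ p ∈ Finset.Icc 6 (j - 3), 2 * (p - 2).choose 4 * f (j - p - 1))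
      + (∑ p ∈ Finset.Icc 0 (j - 9), ∑ q ∈ Finset.Icc 0 (j - p - 9),
          ∑ r ∈ Finset.Icc 0 (j - p - q - 9), ∑ s ∈ Finset.Icc 1 (j - p - q - r - 8),
            ∑ t ∈ Finset.Icc 1 (j - p - q - r - s - 7), 2 * f (j - p - q - r - s - t - 5))
      + (∑ t ∈ Finset.Icc 1 (j - 8), ∑ k ∈ Finset.Icc 1 (j - t - 7),
          ∑ p ∈ Finset.Icc 1 (j - t - k - 6), ∑ l ∈ Finset.Icc 2 (j - t - k - p - 4),
            6 * (l - 1) * f (j - t - k - p - l - 2))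
      + (∑ t ∈ Finset.Icc 1 (j - 8), ∑ h ∈ Finset.Icc 2 (j - t - 6),
          ∑ l ∈ Finset.Icc 1 (j - h - t - 5), ∑ p ∈ Finset.Icc 1 (j - h - t - l - 4),
            2 * (h - 1) * f (j - h - t - l - p - 2)) = 12 * iterSum f 5 (j - 2) := by
  -- In each of the four sums the summations are collapsed from the inside out; `hz` provides the
  -- vanishing needed at every stage. The binomial coefficient of the first sum accounts for all
  -- five summations.
  have hz := iterSum_eq_zero hf
  have e1 : ∑ p ∈ Finset.Icc 6 (j - 3), (p - 2).choose 4 * f (j - p - 1) =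
      iterSum f 5 (j - 2) := by
    rw [sum_Icc_mul_sub (fun p => (p - 2).choose 4) f j 6 3 1 (by omega) hf, iterSum_eq_sum_choose]
    have : Finset.range (j + 1 - 6 - 1) ⊆ Finset.range (j - 2) :=
      Finset.range_subset_range.2 (by omega)
    refine (Finset.sum_congr rfl fun u _ => ?_).trans (Finset.sum_subset this fun u hu hu' => ?_)
    · rw [show j - 1 - u - 2 = j - 2 - 1 - u by omega]
    · rw [Finset.mem_range] at hu hu'
      rw [Nat.choose_eq_zero_of_lt (by omega), zero_mul]
  have e2 : ∑ p ∈ Finset.Icc 0 (j - 9), ∑ q ∈ Finset.Icc 0 (j - p - 9),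
      ∑ r ∈ Finset.Icc 0 (j - p - q - 9), ∑ s ∈ Finset.Icc 1 (j - p - q - r - 8),
        ∑ t ∈ Finset.Icc 1 (j - p - q - r - s - 7), f (j - p - q - r - s - t - 5) =
      iterSum f 5 (j - 2) := by
    have h1 : ∀ J, ∑ t ∈ Finset.Icc 1 (J - 7), f (J - t - 5) = iterSum f 1 (J - 5) := fun J => by
      rw [sum_Icc_sub f J 1 7 5 (by omega) hf, show J + 1 - 1 - 5 = J - 5 by omega]
    have h2 : ∀ J, ∑ s ∈ Finset.Icc 1 (J - 8), iterSum f 1 (J - s - 5) = iterSum f 2 (J - 5) :=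
      fun J => by
      rw [sum_Icc_sub _ J 1 8 5 (by omega) (hz 1), iterSum_iterSum,
        show J + 1 - 1 - 5 = J - 5 by omega]
    have h3 : ∀ J, ∑ r ∈ Finset.Icc 0 (J - 9), iterSum f 2 (J - r - 5) = iterSum f 3 (J - 4) :=
      fun J => by
      rw [sum_Icc_sub _ J 0 9 5 (by omega) (hz 2), iterSum_iterSum,
        show J + 1 - 0 - 5 = J - 4 by omega]
    have h4 : ∀ J, ∑ q ∈ Finset.Icc 0 (J - 9), iterSum f 3 (J - q - 4) = iterSum f 4 (J - 3) :=
      fun J => by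
      rw [sum_Icc_sub _ J 0 9 4 (by omega) (hz 3), iterSum_iterSum,
        show J + 1 - 0 - 4 = J - 3 by omega]
    simp only [h1, h2, h3, h4]
    rw [sum_Icc_sub _ j 0 9 3 (by omega) (hz 4), iterSum_iterSum,
      show j + 1 - 0 - 3 = j - 2 by omega]
  have e3 : ∑ t ∈ Finset.Icc 1 (j - 8), ∑ k ∈ Finset.Icc 1 (j - t - 7),
      ∑ p ∈ Finset.Icc 1 (j - t - k - 6), ∑ l ∈ Finset.Icc 2 (j - t - k - p - 4),
        (l - 1) * f (j - t - k - p - l - 2) = iterSum f 5 (j - 2) := by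
    have h1 : ∀ J, ∑ l ∈ Finset.Icc 2 (J - 4), (l - 1) * f (J - l - 2) = iterSum f 2 (J - 2) :=
      fun J => sum_Icc_pred_mul_sub f J 4 2 (by omega) hf
    have h2 : ∀ J, ∑ p ∈ Finset.Icc 1 (J - 6), iterSum f 2 (J - p - 2) = iterSum f 3 (J - 2) :=
      fun J => by
      rw [sum_Icc_sub _ J 1 6 2 (by omega) (hz 2), iterSum_iterSum,
        show J + 1 - 1 - 2 = J - 2 by omega]
    have h3 : ∀ J, ∑ k ∈ Finset.Icc 1 (J - 7), iterSum f 3 (J - k - 2) = iterSum f 4 (J - 2) :=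
      fun J => by
      rw [sum_Icc_sub _ J 1 7 2 (by omega) (hz 3), iterSum_iterSum,
        show J + 1 - 1 - 2 = J - 2 by omega]
    simp only [h1, h2, h3]
    rw [sum_Icc_sub _ j 1 8 2 (by omega) (hz 4), iterSum_iterSum,
      show j + 1 - 1 - 2 = j - 2 by omega]
  have e4 : ∑ t ∈ Finset.Icc 1 (j - 8), ∑ h ∈ Finset.Icc 2 (j - t - 6), (h - 1) *
      ∑ l ∈ Finset.Icc 1 (j - h - t - 5), ∑ p ∈ Finset.Icc 1 (j - h - t - l - 4),
        f (j - h - t - l - p - 2) = iterSum f 5 (j - 2) := by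
    have h1 : ∀ J, ∑ p ∈ Finset.Icc 1 (J - 4), f (J - p - 2) = iterSum f 1 (J - 2) := fun J => by
      rw [sum_Icc_sub f J 1 4 2 (by omega) hf, show J + 1 - 1 - 2 = J - 2 by omega]
    have h2 : ∀ J, ∑ l ∈ Finset.Icc 1 (J - 5), iterSum f 1 (J - l - 2) = iterSum f 2 (J - 2) :=
      fun J => by
      rw [sum_Icc_sub _ J 1 5 2 (by omega) (hz 1), iterSum_iterSum,
        show J + 1 - 1 - 2 = J - 2 by omega]
    have h3 : ∀ J, ∑ h ∈ Finset.Icc 2 (J - 6), (h - 1) * iterSum f 2 (J - h - 2) =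
        iterSum f 4 (J - 2) := fun J => by
      rw [sum_Icc_pred_mul_sub _ J 6 2 (by omega) (hz 2), iterSum_iterSum]
    -- The summand subtracts h before t while the bound for h is in terms of j - t; commuting the
    -- subtractions lets `h3` apply with J = j - t.
    simp only [h1, h2, Nat.sub_right_comm j _ _, h3]
    rw [sum_Icc_sub _ j 1 8 2 (by omega) (hz 4), iterSum_iterSum,
      show j + 1 - 1 - 2 = j - 2 by omega]
  simp only [mul_assoc, ← Finset.mul_sum]
  rw [e1, e2, e3, e4]
  ring

/-! ### Counting sizes -/

/-- Pairs of positive integers, the smaller one first, together with `k` nonnegative integers, of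
total sum `x`. -/
def PairAndRest (k x : ℕ) : Type :=
  {p : (ℕ × ℕ) × (Fin k → ℕ) // 1 ≤ p.1.1 ∧ p.1.1 ≤ p.1.2 ∧ p.1.1 + p.1.2 + ∑ i, p.2 i = x}

/-- Pairs of positive integers, the smaller one first, are partitions into two parts. -/
def PairAndRest.toPartition {x : ℕ} (p : PairAndRest 0 x) :
    {p : x.Partition // Multiset.card p.parts = 2} :=
  ⟨{ parts := {p.1.1.1, p.1.1.2}
     parts_pos := by
      intro i hi
      have h1 := p.2.1
      have h2 := p.2.2.1
      simp only [Multiset.insert_eq_cons, Multiset.mem_cons, Multiset.mem_singleton] at hi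
      omega
     parts_sum := by
      have := p.2.2.2
      simpa using this }, rfl⟩

lemma PairAndRest.toPartition_bijective (x : ℕ) :
    Function.Bijective (PairAndRest.toPartition (x := x)) := by
  constructor
  · rintro ⟨⟨⟨a, b⟩, v⟩, h1, h2, h3⟩ ⟨⟨⟨a', b'⟩, v'⟩, h1', h2', h3'⟩ h
    have h4 : ({a, b} : Multiset ℕ) = {a', b'} := congrArg (fun q => q.1.parts) h
    simp only [Finset.univ_eq_empty, Finset.sum_empty, add_zero] at h1 h2 h3 h1' h2' h3'
    have h5 : a ∈ ({a', b'} : Multiset ℕ) := h4 ▸ by simp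
    have h6 : a' ∈ ({a, b} : Multiset ℕ) := h4 ▸ by simp
    simp only [Multiset.insert_eq_cons, Multiset.mem_cons, Multiset.mem_singleton] at h5 h6
    obtain rfl : a = a' := by omega
    obtain rfl : b = b' := by omega
    obtain rfl := Subsingleton.elim v v'
    rfl
  · rintro ⟨q, hq⟩
    obtain ⟨a, b, hab⟩ := Multiset.card_eq_two.1 hq
    wlog hle : a ≤ b generalizing a b with H
    · exact H b a (hab.trans (Multiset.pair_comm a b)) (le_of_not_ge hle)
    refine ⟨⟨((a, b), ![]), q.parts_pos (hab ▸ by simp), hle, ?_⟩, ?_⟩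
    · have := q.parts_sum
      rw [hab] at this
      simpa using this
    · exact Subtype.ext (Nat.Partition.ext hab.symm)

/-- A further nonnegative integer with given total sum. -/
def PairAndRest.cons (k x : ℕ) (p : Σ u : Fin (x + 1), PairAndRest k u) : PairAndRest (k + 1) x :=
  ⟨(p.2.1.1, Fin.cons (x - p.1) p.2.1.2), p.2.2.1, p.2.2.2.1, by
    have h1 := p.2.2.2.2
    have h2 := p.1.2
    rw [Fin.sum_univ_succ]
    simp only [Fin.cons_zero, Fin.cons_succ]
    omega⟩

lemma PairAndRest.cons_bijective (k x : ℕ) : Function.Bijective (PairAndRest.cons k x) := by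
  constructor
  · rintro ⟨⟨u, hu⟩, ⟨p, v⟩, h1, h2, h3⟩ ⟨⟨u', hu'⟩, ⟨p', v'⟩, h1', h2', h3'⟩ h
    have h4 := congrArg Subtype.val h
    simp only [PairAndRest.cons, Prod.mk.injEq] at h4
    obtain ⟨rfl, h5⟩ := h4
    obtain ⟨-, rfl⟩ := Fin.cons_inj.1 h5
    simp only at h3 h3'
    subst h3
    subst h3'
    rfl
  · rintro ⟨⟨p, v⟩, h1, h2, h3⟩
    rw [Fin.sum_univ_succ] at h3
    simp only at h1 h2 h3
    refine ⟨⟨⟨x - v 0, by omega⟩, ⟨(p, Fin.tail v), h1, h2, ?_⟩⟩, Subtype.ext (Prod.ext rfl ?_)⟩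
    · simp only [Fin.tail]
      omega
    · change Fin.cons (x - (x - v 0)) (Fin.tail v) = v
      rw [show x - (x - v 0) = v 0 by omega, Fin.cons_self_tail]

instance (k x : ℕ) : Finite (PairAndRest k x) := by
  induction k generalizing x with
  | zero => exact Finite.of_injective _ (PairAndRest.toPartition_bijective x).1
  | succ k ih => exact Finite.of_surjective _ (PairAndRest.cons_bijective k x).2

lemma numPartitions_two_eq_zero : ∀ u < 2, numPartitions 2 u = 0 := by
  intro u hu
  rw [numPartitions, ← Nat.card_eq_of_bijective _ (PairAndRest.toPartition_bijective u)]
  have : IsEmpty (PairAndRest 0 u) := ⟨fun p => by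
    have h1 := p.2.1
    have h2 := p.2.2.1
    have h3 := p.2.2.2
    omega⟩
  exact Nat.card_of_isEmpty

/-- Splitting off one nonnegative integer sums the count over all totals u ≤ x. The argument is
shifted by k because each iterated sum stops short of its bound. -/
lemma natCard_pairAndRest (k x : ℕ) :
    Nat.card (PairAndRest k x) = iterSum (numPartitions 2) k (x + k) := by
  induction k generalizing x with
  | zero => exact Nat.card_eq_of_bijective _ (PairAndRest.toPartition_bijective x)
  | succ k ih =>
    rw [← Nat.card_eq_of_bijective _ (PairAndRest.cons_bijective k x), Nat.card_sigma]
    simp only [ih]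
    -- The first k terms of the range vanish; the other x + 1 are the totals u = 0, ..., x.
    rw [iterSum_succ, show x + (k + 1) = k + (x + 1) by ring, Finset.sum_range_add,
      Finset.sum_eq_zero fun u hu => iterSum_eq_zero numPartitions_two_eq_zero k u (by
        rw [Finset.mem_range] at hu
        omega), zero_add, Finset.sum_range]
    exact Finset.sum_congr rfl fun u _ => by rw [add_comm]

/-- The admissible sizes of the seven slots with given sum. -/
def Sizes (x : ℕ) : Type := {n : Fin 7 → ℕ // AreSizes n ∧ ∑ k, n k = x}

/-- The sizes of the slots from a pair and five nonnegative integers. -/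
def PairAndRest.toSizes {x : ℕ} (p : PairAndRest 5 x) : Sizes (x + 2) :=
  ⟨![p.1.1.1, p.1.1.2, p.1.2 0 + 1, p.1.2 1 + 1, p.1.2 2, p.1.2 3, p.1.2 4],
    ⟨p.2.1, p.2.2.1, Nat.le_add_left _ _, Nat.le_add_left _ _⟩, by
      have := p.2.2.2
      rw [Fin.sum_univ_five] at this
      rw [Fin.sum_univ_seven]
      simp
      omega⟩

lemma PairAndRest.toSizes_bijective (x : ℕ) :
    Function.Bijective (PairAndRest.toSizes (x := x)) := by
  constructor
  · rintro ⟨⟨⟨a, b⟩, v⟩, h1, h2, h3⟩ ⟨⟨⟨a', b'⟩, v'⟩, h1', h2', h3'⟩ h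
    have h4 := congrArg Subtype.val h
    refine Subtype.ext (Prod.ext (Prod.ext (congrFun h4 0) (congrFun h4 1)) (funext fun i => ?_))
    fin_cases i
    · exact Nat.succ_injective (congrFun h4 2)
    · exact Nat.succ_injective (congrFun h4 3)
    · exact congrFun h4 4
    · exact congrFun h4 5
    · exact congrFun h4 6
  · rintro ⟨n, ⟨h0, h1, h2, h3⟩, hx⟩
    refine ⟨⟨((n 0, n 1), ![n 2 - 1, n 3 - 1, n 4, n 5, n 6]), h0, h1, ?_⟩, Subtype.ext ?_⟩
    · rw [Fin.sum_univ_seven] at hx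
      rw [Fin.sum_univ_five]
      simp
      omega
    · funext i
      fin_cases i
      · rfl
      · rfl
      · exact Nat.sub_add_cancel h2
      · exact Nat.sub_add_cancel h3
      · rfl
      · rfl
      · rfl

lemma natCard_sizes (x : ℕ) : Nat.card (Sizes (x + 2)) = iterSum (numPartitions 2) 5 (x + 5) := by
  rw [← natCard_pairAndRest, Nat.card_eq_of_bijective _ (PairAndRest.toSizes_bijective x)]

/-! ### Isomorphism classes of labelled blocks -/

/-- A lattice structure transported along a bijection. -/
@[reducible]
noncomputable def latticeOfEquiv {α β : Type} [Lattice β] (e : α ≃ β) : Lattice α where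
  le x y := e x ≤ e y
  le_refl x := le_refl (e x)
  le_trans x y z := le_trans (a := e x)
  le_antisymm x y h h' := e.injective (le_antisymm h h')
  sup x y := e.symm (e x ⊔ e y)
  inf x y := e.symm (e x ⊓ e y)
  le_sup_left x y := by simp
  le_sup_right x y := by simp
  sup_le x y z hx hy := by simp [hx, hy]
  inf_le_left x y := by simp
  inf_le_right x y := by simp
  le_inf x y z hx hy := by simp [hx, hy]

/-- The bijection along which a lattice structure is transported is an isomorphism. -/
noncomputable def latticeOfEquivIso {α β : Type} [Lattice β] (e : α ≃ β) :
    @OrderIso α β (latticeOfEquiv e).toLE _ :=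
  let _ := latticeOfEquiv e
  { toEquiv := e
    map_rel_iff' := Iff.rfl }

lemma isBlockOfType_latticeOfEquiv {α β : Type} [Lattice β] (e : α ≃ β) {r k h : ℕ}
    (hβ : IsBlockOfType β r k h) : @IsBlockOfType α (latticeOfEquiv e) r k h :=
  let _ := latticeOfEquiv e
  hβ.of_orderIso (latticeOfEquivIso e).symm

lemma nonempty_orderIso_of_labelled {α β γ : Type} (L M : Lattice α) [LE β] [LE γ]
    (e : @OrderIso α α L.toLE M.toLE) (f : @OrderIso α β L.toLE _)
    (f' : @OrderIso α γ M.toLE _) : Nonempty (β ≃o γ) :=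
  ⟨@OrderIso.trans β α γ _ L.toLE _ (@OrderIso.symm α β L.toLE _ f)
    (@OrderIso.trans α α γ L.toLE M.toLE _ e f')⟩

lemma nonempty_labelled_orderIso {α β : Type} (L M : Lattice α) [LE β]
    (f : @OrderIso α β L.toLE _) (f' : @OrderIso β α _ M.toLE) :
    Nonempty (@OrderIso α α L.toLE M.toLE) :=
  ⟨@OrderIso.trans α β α L.toLE _ M.toLE f f'⟩

/-- The model with given shape and sizes has five elements more than its slots. -/
lemma natCard_shapeData_pt {g : Fin 12} {n : Fin 7 → ℕ} {hn : AreSizes n} :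
    Nat.card (shapeData g n hn).Pt = 5 + ∑ k, n k :=
  SlotData.Pt.natCard_eq _

/-- A numbering of the elements of the model with given shape and sizes. -/
noncomputable def shapeEquiv {x : ℕ} (g : Fin 12) (n : Sizes x) :
    Fin (5 + x) ≃ (shapeData g n.1 n.2.1).Pt :=
  (Finite.equivFinOfCardEq (natCard_shapeData_pt.trans (by rw [n.2.2]))).symm

/-- The block with given shape and sizes. -/
noncomputable def shapeBlock (x : ℕ) (p : Fin 12 × Sizes x) : LabelledBlock (5 + x) 5 3 5 :=
  ⟨latticeOfEquiv (shapeEquiv p.1 p.2),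
    isBlockOfType_latticeOfEquiv _ (isBlockOfType_shapeData p.1 p.2.1 p.2.2.1)⟩

/-- The isomorphism class of the block with given shape and sizes. -/
noncomputable def shapeClass (x : ℕ) (p : Fin 12 × Sizes x) : BlockClass (5 + x) 5 3 5 :=
  Quotient.mk (isoSetoid (5 + x) 5 3 5) (shapeBlock x p)

/-- Injectivity is the invariance of shape and sizes, surjectivity the decomposition of a block into
slots; comparing cardinalities gives the total size x. -/
lemma shapeClass_bijective (x : ℕ) : Function.Bijective (shapeClass x) := by
  constructor
  · intro p q h
    obtain ⟨e⟩ : Nonempty (@OrderIso (Fin (5 + x)) (Fin (5 + x)) (shapeBlock x p).1.toLE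
      (shapeBlock x q).1.toLE) := Quotient.exact h
    obtain ⟨φ⟩ := nonempty_orderIso_of_labelled (shapeBlock x p).1 (shapeBlock x q).1
      e (latticeOfEquivIso (shapeEquiv p.1 p.2))
      (latticeOfEquivIso (shapeEquiv q.1 q.2))
    obtain ⟨h1, h2⟩ := eq_of_shapeData_orderIso φ
    exact Prod.ext h1 (Subtype.ext h2)
  · intro b
    obtain ⟨⟨L, hL⟩, rfl⟩ := Quotient.exists_rep b
    obtain ⟨g, n, hn, ⟨e⟩⟩ := @exists_shapeData_of_isBlockOfType _ L _ hL
    have hx : ∑ k, n k = x := by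
      have h1 := Nat.card_congr e.toEquiv
      rw [natCard_shapeData_pt, Nat.card_eq_fintype_card, Fintype.card_fin] at h1
      omega
    let p : Fin 12 × Sizes x := (g, ⟨n, hn, hx⟩)
    have h : (isoSetoid (5 + x) 5 3 5).r (shapeBlock x p) ⟨L, hL⟩ :=
      nonempty_labelled_orderIso (shapeBlock x p).1 L (latticeOfEquivIso (shapeEquiv p.1 p.2)) e
    exact ⟨p, Quotient.sound h⟩

lemma natCard_blockClass (y : ℕ) :
    Nat.card (BlockClass (5 + (y + 2)) 5 3 5) = 12 * iterSum (numPartitions 2) 5 (y + 5) := by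
  rw [← Nat.card_eq_of_bijective _ (shapeClass_bijective (y + 2)), Nat.card_prod, natCard_sizes,
    Nat.card_eq_fintype_card, Fintype.card_fin]

end LatticeCount

theorem mainTheorem4 (j : ℕ) (hj : 9 ≤ j) :
    Nat.card (LatticeCount.BlockClass j 5 3 5) =
      (∑ p ∈ Finset.Icc 6 (j - 3),
        2 * (p - 2).choose 4 * LatticeCount.numPartitions 2 (j - p - 1))
      + (∑ p ∈ Finset.Icc 0 (j - 9), ∑ q ∈ Finset.Icc 0 (j - p - 9),
          ∑ r ∈ Finset.Icc 0 (j - p - q - 9), ∑ s ∈ Finset.Icc 1 (j - p - q - r - 8),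
          ∑ t ∈ Finset.Icc 1 (j - p - q - r - s - 7),
            2 * LatticeCount.numPartitions 2 (j - p - q - r - s - t - 5))
      + (∑ t ∈ Finset.Icc 1 (j - 8), ∑ k ∈ Finset.Icc 1 (j - t - 7),
          ∑ p ∈ Finset.Icc 1 (j - t - k - 6), ∑ l ∈ Finset.Icc 2 (j - t - k - p - 4),
            6 * (l - 1) * LatticeCount.numPartitions 2 (j - t - k - p - l - 2))
      + (∑ t ∈ Finset.Icc 1 (j - 8), ∑ h ∈ Finset.Icc 2 (j - t - 6),
          ∑ l ∈ Finset.Icc 1 (j - h - t - 5), ∑ p ∈ Finset.Icc 1 (j - h - t - l - 4),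
            2 * (h - 1) * LatticeCount.numPartitions 2 (j - h - t - l - p - 2)) := by
  -- Five elements form the main chain, and the two ears outside the doubled gap need at least one
  -- element each; y is what remains to be distributed.
  obtain ⟨y, rfl⟩ : ∃ y, j = 5 + (y + 2) := ⟨j - 7, by omega⟩
  rw [LatticeCount.sums_eq_iterSum _ LatticeCount.numPartitions_two_eq_zero,
    LatticeCount.natCard_blockClass, show 5 + (y + 2) - 2 = y + 5 by omega]
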